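/- For a group $G$ and a natural number $n\ge 2$, let $\mathcal K(G,n)$ be the kernel of the homomorphism $G^n\to G^{\rm ab}=G/[G,G]$, $(g_1,\dots,g_n)\mapsto \overline{g_1\cdots g_n}$. Choose a presentation $G\cong F/N$ with $F$ a free group, let $\langle\!\langle\mathcal K(N,n)\rangle\!\rangle$ be the normal closure of $\mathcal K(N,n)$ in $F^n$, and put $\widetilde{\mathcal K}(G,n):=\mathcal K(F,n)/\langle\!\langle\mathcal K(N,n)\rangle\!\rangle$ (up to isomorphism this does not depend on the presentation). A cover of a finite group $G$ is a surjective homomorphism $G^*\to G$ whose kernel $M$ lies in the centre $Z(G^*)$ and in the commutator subgroup $[G^*,G^*]$ and is isomorphic to the Schur multiplier $H^2(G,\mathbb C^*)$ of $G$ (with trivial action on $\mathbb C^*$). Let $p$ be a prime, $G$ a finite Abelian $p$-group and $n\ge 3$ a natural number. Then the following hold, whichever presentations of $G$ are used (possibly different ones for $n$ and for $n-1$). (1) If the exponent of $G$ divides $n$, then $\widetilde{\mathcal K}(G,n)\cong G\times\widetilde{\mathcal K}(G,n-1)$. (2) If $p$ does not divide $n$, then for every cover $G^*\to G$, with $Z$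 the image of the centre $Z(G^*)$ in $G$, the centre of $\widetilde{\mathcal K}(G,n)$ is isomorphic to $H_2(G,\mathbb Z)\times\mathcal K(Z,n)$. -/

import Mathlib

universe u v

/-- The homomorphism `ψ : Gⁿ → G^ab`, `(g₁, …, gₙ) ↦ class of g₁ ⋯ gₙ`. -/
def psiHom (G : Type v) [Group G] (n : ℕ) : (Fin n → G) →* Abelianization G where
  toFun g := ∏ i, Abelianization.of (g i)
  map_one' := by simp
  map_mul' a b := by simp [Finset.prod_mul_distrib]

/-- `psiHom` sends `g` to the class of the ordered product `g₁ ⋯ gₙ`. -/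
theorem psiHom_apply (G : Type v) [Group G] (n : ℕ) (g : Fin n → G) :
    psiHom G n g = Abelianization.of (List.ofFn g).prod := by
  simp [psiHom, map_list_prod, List.map_ofFn, List.prod_ofFn]

/-- `𝒦(G, n)`, the kernel of `ψ : Gⁿ → G^ab`. -/
def KGroup (G : Type v) [Group G] (n : ℕ) : Subgroup (Fin n → G) :=
  (psiHom G n).ker

/-- For a homomorphism `π : F → G` with kernel `N`, the normal closure in `Fⁿ` of `𝒦(N, n)`,
where `𝒦(N, n) ≤ Nⁿ` is regarded as a subgroup of `Fⁿ`. -/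
def KRel {F : Type v} {G : Type u} [Group F] [Group G] (π : F →* G) (n : ℕ) :
    Subgroup (Fin n → F) :=
  Subgroup.normalClosure
    (((KGroup π.ker n).map (π.ker.subtype.compLeft (Fin n)) : Subgroup (Fin n → F)) :
      Set (Fin n → F))

instance KRel_normal {F : Type v} {G : Type u} [Group F] [Group G] (π : F →* G) (n : ℕ) :
    (KRel π n).Normal :=
  Subgroup.normalClosure_normal

/-- The relations lie in `𝒦(F, n)`, so that the quotient below is the quotient by all of them. -/
theorem KRel_le {F : Type v} {G : Type u} [Group F] [Group G] (π : F →* G) (n : ℕ) :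
    KRel π n ≤ KGroup F n := by
  have : (KGroup F n).Normal := MonoidHom.normal_ker _
  refine Subgroup.normalClosure_le_normal ?_
  rintro _ ⟨x, hx, rfl⟩
  have h := congrArg (Abelianization.map π.ker.subtype) (MonoidHom.mem_ker.1 hx)
  refine MonoidHom.mem_ker.2 ?_
  simpa [psiHom, map_prod] using h

/-- `𝒦̃(G, n) = 𝒦(F, n) / ⟪𝒦(N, n)⟫`, computed from a presentation `π : F → G` of `G`
(a surjection from a free group `F`) with kernel `N`. -/
abbrev KTilde {F : Type v} {G : Type u} [Group F] [Group G] (π : F →* G) (n : ℕ) : Type v :=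
  KGroup F n ⧸ (KRel π n).subgroupOf (KGroup F n)

/-- The integral homology group `H₂(G, ℤ)`. Mathlib wants the coefficient ring in the universe of
the group, hence the lift of `ℤ`. -/
abbrev IntegralH2 (G : Type u) [Group G] : Type u :=
  groupHomology (Rep.trivial (ULift.{u} ℤ) G (ULift.{u} ℤ)) 2

/-- The Schur multiplier `M(G) = H²(G, ℂˣ)` for the trivial action of `G` on `ℂˣ`, written
additively. -/
abbrev SchurMultiplier (G : Type u) [Group G] : Type u :=
  groupCohomology (Rep.trivial (ULift.{u} ℤ) G (Additive (ULift.{u} ℂˣ))) 2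

/-- `q : E → G` is a cover of `G`: a central extension of `G` whose kernel lies in the
commutator subgroup `[E, E]` and is isomorphic to the Schur multiplier of `G`. -/
structure IsGroupCover {E : Type v} {G : Type u} [Group E] [Group G] (q : E →* G) : Prop where
  surjective : Function.Surjective q
  ker_le_center : q.ker ≤ Subgroup.center E
  ker_le_commutator : q.ker ≤ commutator E
  ker_iso : Nonempty (q.ker ≃* Multiplicative (SchurMultiplier G))

-- Write `N` for the kernel of `π`. A tuple of `Fⁿ` lies in `KRel π n` exactly when its entries lie
-- in `N` and its ordered product lies in `[F, N]` (`mem_KRel_iff`). Hence `F` may be replaced by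
-- the central extension `E = F / [F, N]` of `G` (`KTilde.bijective_map_mk`), where the relations
-- become: entries in the kernel, product `1`. As `E` maps over `G` to every central extension and
-- endomorphisms of `E` over `G` act trivially on `KTilde` (`KTilde.map_eq_self`), the presentation
-- does not matter. As `G` is abelian, `[E, E]` is central and commutators in `E` are
-- bimultiplicative.
--
-- (1) Let `n = m + 1`. The first coordinate maps `KTilde` for `n` onto `G`, with kernel the copy `x
-- ↦ (1, x)` of `KTilde` for `m`. If the exponent divides `n`, the class of `(e⁻ᵐ, e, …, e)` is
-- central, lies over the image of `e`, and is killed by the order of that image. Such lifts of a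
-- basis of `G` give a central section, so the extension is a direct product.
--
-- (2) If the class of `x` is central, then all `xᵢ` agree modulo the centre of `E`; their images
-- multiply to `1`, so the `n`-th power of each has image in `Z`, and `p ∤ n` makes each `xᵢ`
-- central. Sending a central tuple to its product and its images in `G` identifies the centre with
-- `[E, E] × 𝒦(Z, n)`. Hopf's formula gives `[E, E] ≅ H₂(G, ℤ)`. It remains to see that `E` and a
-- cover have the same `Z`: characters of `[E, E]` embed by transgression in the Schur multiplier,
-- so the surjection from `[E, E]` to the commutator subgroup of the cover is injective by counting.

universe w

open scoped commutatorElement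

/-! ### Ordered products of tuples -/

section Product

variable {G : Type*} [Group G]

theorem commutator_le_ker_of_commute {K : Type*} [Group K] (f : G →* K)
    (h : ∀ a b, f a * f b = f b * f a) : commutator G ≤ f.ker := by
  rw [commutator_def, Subgroup.commutator_le]
  intro a _ b _
  rw [MonoidHom.mem_ker, map_commutatorElement, commutatorElement_eq_one_iff_mul_comm]
  exact h a b

theorem mem_KGroup_iff {n : ℕ} {g : Fin n → G} :
    g ∈ KGroup G n ↔ (List.ofFn g).prod ∈ commutator G := by
  rw [KGroup, MonoidHom.mem_ker, psiHom_apply, ← Abelianization.ker_of, MonoidHom.mem_ker]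

theorem psiHom_mulSingle {n : ℕ} (i : Fin n) (g : G) :
    psiHom G n (Pi.mulSingle i g) = Abelianization.of g := by
  simp only [psiHom, MonoidHom.coe_mk, OneHom.coe_mk]
  rw [Finset.prod_eq_single i]
  · simp
  · intro b _ hb
    simp [Pi.mulSingle_eq_of_ne hb]
  · simp

theorem prod_ofFn_mulSingle {n : ℕ} (i : Fin n) (g : G) :
    (List.ofFn (Pi.mulSingle i g : Fin n → G)).prod = g := by
  induction n with
  | zero => exact i.elim0
  | succ n ih =>
    rw [List.ofFn_succ, List.prod_cons]
    induction i using Fin.cases with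
    | zero =>
      simp
    | succ i =>
      have : (fun k : Fin n => (Pi.mulSingle i.succ g : Fin (n + 1) → G) k.succ) =
          Pi.mulSingle i g := by
        funext k
        by_cases h : k = i
        · subst h; simp
        · rw [Pi.mulSingle_eq_of_ne h, Pi.mulSingle_eq_of_ne (by simpa using h)]
      rw [this, ih, Pi.mulSingle_eq_of_ne (Fin.succ_ne_zero i).symm, one_mul]

/-- The ordered product is not a homomorphism in general, but central factors can be moved to the
right end. -/
theorem prod_ofFn_mul_of_mem_center {n : ℕ} (x y : Fin n → G)
    (hy : ∀ i, y i ∈ Subgroup.center G) :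
    (List.ofFn (x * y)).prod = (List.ofFn x).prod * (List.ofFn y).prod := by
  induction n with
  | zero => simp
  | succ n ih =>
    have h := ih (x ∘ Fin.succ) (y ∘ Fin.succ) fun i => hy _
    simp only [List.ofFn_succ, List.prod_cons, Pi.mul_apply]
    have h' : (List.ofFn fun i : Fin n => x i.succ * y i.succ).prod =
      (List.ofFn (x ∘ Fin.succ)).prod * (List.ofFn (y ∘ Fin.succ)).prod := h
    rw [h', mul_assoc, ← mul_assoc (y 0), ← Subgroup.mem_center_iff.1 (hy 0)]
    simp only [mul_assoc]
    rfl

theorem map_prod_ofFn {H : Type*} [Group H] (f : G →* H) {n : ℕ} (x : Fin n → G) :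
    f (List.ofFn x).prod = (List.ofFn (fun i => f (x i))).prod := by
  rw [map_list_prod, List.map_ofFn]
  rfl

theorem prod_ofFn_inv_of_mem_center {n : ℕ} (y : Fin n → G)
    (hy : ∀ i, y i ∈ Subgroup.center G) :
    (List.ofFn y⁻¹).prod = ((List.ofFn y).prod)⁻¹ := by
  rw [eq_inv_iff_mul_eq_one, ← prod_ofFn_mul_of_mem_center _ _ hy, inv_mul_cancel]
  have : (List.ofFn (1 : Fin n → G)) = List.replicate n 1 := List.ofFn_const n 1
  simp [this]

end Product

/-! ### The normal closure of `𝒦(N, n)` made explicit -/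

section Relators

variable {F : Type v} {G : Type u} [Group F] [Group G] (π : F →* G)

/-- The subgroup `[F, N]` for `N` the kernel of `π`. -/
abbrev relComm : Subgroup F := ⁅(⊤ : Subgroup F), π.ker⁆

theorem relComm_le_ker : relComm π ≤ π.ker := Subgroup.commutator_le_right _ _

theorem relComm_le_commutator : relComm π ≤ commutator F :=
  Subgroup.commutator_mono le_rfl le_top

theorem mk_mem_center {x : F} (hx : x ∈ π.ker) :
    (QuotientGroup.mk' (relComm π) x) ∈ Subgroup.center (F ⧸ relComm π) := by
  rw [Subgroup.mem_center_iff]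
  intro g
  obtain ⟨f, rfl⟩ := QuotientGroup.mk'_surjective _ g
  rw [← commutatorElement_eq_one_iff_mul_comm, ← map_commutatorElement, ← MonoidHom.mem_ker,
    QuotientGroup.ker_mk']
  exact Subgroup.commutator_mem_commutator (Subgroup.mem_top _) hx

/-- The tuple with `m` at `i` and `m⁻¹` at some `j ≠ i` is a relation. Conjugating it by `f` at
place `i` and dividing by the original leaves `⁅f, m⁆` at `i` alone. -/
theorem mulSingle_mem_KRel {n : ℕ} (hn : 2 ≤ n) (i : Fin n) {c : F} (hc : c ∈ relComm π) :
    Pi.mulSingle i c ∈ KRel π n := by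
  classical
  suffices h : relComm π ≤ (KRel π n).comap (MonoidHom.mulSingle (fun _ => F) i) from h hc
  rw [Subgroup.commutator_le]
  intro f _ m hm
  have : Nontrivial (Fin n) := Fin.nontrivial_iff_two_le.2 hn
  obtain ⟨j, hj⟩ := exists_ne i
  let s : Fin n → π.ker := Pi.mulSingle i ⟨m, hm⟩ * Pi.mulSingle j ⟨m, hm⟩⁻¹
  have hs : s ∈ KGroup π.ker n := by
    rw [KGroup, MonoidHom.mem_ker, map_mul]
    rw [psiHom_mulSingle, psiHom_mulSingle, map_inv, mul_inv_cancel]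
  have hs' : π.ker.subtype.compLeft (Fin n) s ∈ KRel π n :=
    Subgroup.subset_normalClosure ⟨s, hs, rfl⟩
  have := (KRel π n).mul_mem ((KRel_normal π n).conj_mem _ hs' (Pi.mulSingle i f))
    ((KRel π n).inv_mem hs')
  rw [Subgroup.mem_comap]
  convert this using 1
  funext k
  by_cases hk : k = i
  · subst hk
    simp [s, commutatorElement_def, Pi.mulSingle_eq_of_ne hj.symm]
  · have h1 : (Pi.mulSingle i f : Fin n → F) k = 1 := Pi.mulSingle_eq_of_ne hk _
    have h2 : (Pi.mulSingle i ⁅f, m⁆ : Fin n → F) k = 1 := Pi.mulSingle_eq_of_ne hk _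
    change (Pi.mulSingle i ⁅f, m⁆ : Fin n → F) k = _
    rw [Pi.mul_apply, Pi.mul_apply, Pi.mul_apply, Pi.inv_apply, Pi.inv_apply, h1, h2]
    simp

/-- Dividing the entry at place `0` by the product `c ∈ [F, N]` yields an element of `𝒦(N, n)`; the
factor removed is itself a relation. -/
theorem mem_KRel_of {n : ℕ} (hn : 2 ≤ n) {x : Fin n → F} (hx : ∀ i, x i ∈ π.ker)
    (hp : (List.ofFn x).prod ∈ relComm π) : x ∈ KRel π n := by
  have h0 : 0 < n := by omega
  set c := (List.ofFn x).prod with hc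
  have h1 : Pi.mulSingle (⟨0, h0⟩ : Fin n) c ∈ KRel π n := mulSingle_mem_KRel π hn _ hp
  let y : Fin n → π.ker := fun i => ⟨x i, hx i⟩
  let d : π.ker := ⟨c, relComm_le_ker π hp⟩
  have hd : (List.ofFn y).prod = d := by
    apply Subtype.ext
    change π.ker.subtype _ = _
    rw [map_prod_ofFn]
    rfl
  have hs : (y * (Pi.mulSingle (⟨0, h0⟩ : Fin n) d)⁻¹) ∈ KGroup π.ker n := by
    rw [KGroup, MonoidHom.mem_ker, map_mul, map_inv, psiHom_mulSingle, psiHom_apply, hd,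
      mul_inv_cancel]
  have hs' : π.ker.subtype.compLeft (Fin n) _ ∈ KRel π n :=
    Subgroup.subset_normalClosure ⟨_, hs, rfl⟩
  have := (KRel π n).mul_mem hs' h1
  convert this using 1
  funext k
  by_cases hk : k = ⟨0, h0⟩
  · subst hk
    simp [y, d]
  · simp [y, Pi.mulSingle_eq_of_ne hk]

/-- Modulo `[F, N]` the entries are central, so conjugation has no effect, products are
multiplicative, and `[N, N]` dies. -/
theorem ker_and_prod_of_mem_KRel {n : ℕ} {x : Fin n → F} (h : x ∈ KRel π n) :
    (∀ i, x i ∈ π.ker) ∧ (List.ofFn x).prod ∈ relComm π := by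
  have key : ∀ y : F, y ∈ relComm π ↔ QuotientGroup.mk' (relComm π) y = 1 := fun y => by
    rw [← MonoidHom.mem_ker, QuotientGroup.ker_mk']
  simp only [key, map_prod_ofFn]
  unfold KRel Subgroup.normalClosure at h
  induction h using Subgroup.closure_induction with
  | mem x hx =>
    obtain ⟨s, ⟨t, ht, rfl⟩, hs⟩ := Group.mem_conjugatesOfSet_iff.1 hx
    obtain ⟨f, rfl⟩ := isConj_iff.1 hs
    have h1 : ∀ i, (f * (π.ker.subtype.compLeft (Fin n)) t * f⁻¹) i =
      f i * (t i : F) * (f i)⁻¹ := fun i => rfl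
    refine ⟨fun i => ?_, ?_⟩
    · rw [h1]
      exact π.normal_ker.conj_mem _ (t i).2 _
    · have h2 : ∀ i, QuotientGroup.mk' (relComm π)
          ((f * (π.ker.subtype.compLeft (Fin n)) t * f⁻¹) i) =
          (QuotientGroup.mk' (relComm π)).comp π.ker.subtype (t i) := by
        intro i
        rw [h1, map_mul, map_mul, Subgroup.mem_center_iff.1 (mk_mem_center π (t i).2), map_inv,
          mul_inv_cancel_right]
        rfl
      simp only [h2]
      rw [← map_prod_ofFn, ← MonoidHom.mem_ker]
      exact commutator_le_ker_of_commute ((QuotientGroup.mk' (relComm π)).comp π.ker.subtype) (fun _ b =>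
        Subgroup.mem_center_iff.1 (mk_mem_center π b.2) _) (mem_KGroup_iff.1 ht)
  | one =>
    refine ⟨fun i => one_mem _, ?_⟩
    simp
  | mul x y _ _ hx hy =>
    refine ⟨fun i => mul_mem (hx.1 i) (hy.1 i), ?_⟩
    have := prod_ofFn_mul_of_mem_center (fun i => QuotientGroup.mk' (relComm π) (x i))
      (fun i => QuotientGroup.mk' (relComm π) (y i)) fun i => mk_mem_center π (hy.1 i)
    rw [hx.2, hy.2, mul_one] at this
    exact this
  | inv x _ hx =>
    refine ⟨fun i => inv_mem (hx.1 i), ?_⟩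
    have := prod_ofFn_inv_of_mem_center (fun i => QuotientGroup.mk' (relComm π) (x i))
      fun i => mk_mem_center π (hx.1 i)
    rw [hx.2, inv_one] at this
    exact this

theorem mem_KRel_iff {n : ℕ} (hn : 2 ≤ n) {x : Fin n → F} :
    x ∈ KRel π n ↔ (∀ i, π (x i) = 1) ∧ (List.ofFn x).prod ∈ relComm π :=
  ⟨ker_and_prod_of_mem_KRel π, fun h => mem_KRel_of π hn h.1 h.2⟩

theorem relComm_eq_bot (h : π.ker ≤ Subgroup.center F) : relComm π = ⊥ := by
  rw [relComm, Subgroup.commutator_comm, Subgroup.commutator_eq_bot_iff_le_centralizer]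
  rwa [Subgroup.coe_top, Subgroup.centralizer_univ]

theorem mem_KRel_iff_of_central (h : π.ker ≤ Subgroup.center F) {n : ℕ} (hn : 2 ≤ n)
    {x : Fin n → F} :
    x ∈ KRel π n ↔ (∀ i, π (x i) = 1) ∧ (List.ofFn x).prod = 1 := by
  rw [mem_KRel_iff π hn, relComm_eq_bot π h, Subgroup.mem_bot]

end Relators

/-! ### Functoriality and reduction to central extensions -/

section Functoriality

variable {F : Type v} {F' : Type w} {G : Type u} [Group F] [Group F'] [Group G]
  {π : F →* G} {π' : F' →* G}

/-- The map `𝒦(F, n) → 𝒦(F', n)` induced by a homomorphism `F → F'`. -/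
def KGroup.map (φ : F →* F') (n : ℕ) : KGroup F n →* KGroup F' n :=
  ((φ.compLeft (Fin n)).comp (KGroup F n).subtype).codRestrict _ fun x => by
    rw [mem_KGroup_iff]
    have h := mem_KGroup_iff.1 x.2
    have h2 : φ (List.ofFn x.1).prod ∈ commutator F' :=
      (Subgroup.map_le_iff_le_comap.1 (show (commutator F).map φ ≤ commutator F' by
        rw [commutator_def, Subgroup.map_commutator]
        exact Subgroup.commutator_mono le_top le_top)) h
    rw [map_prod_ofFn] at h2
    exact h2

theorem relComm_map_le (φ : F →* F') (h : π'.comp φ = π) :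
    relComm π ≤ (relComm π').comap φ := by
  rw [Subgroup.commutator_le]
  intro a _ b hb
  rw [Subgroup.mem_comap, map_commutatorElement]
  refine Subgroup.commutator_mem_commutator (Subgroup.mem_top _) ?_
  rw [MonoidHom.mem_ker, ← MonoidHom.comp_apply, h]
  exact hb

theorem KRel_map_mem (φ : F →* F') (h : π'.comp φ = π) {n : ℕ} (hn : 2 ≤ n) {x : Fin n → F}
    (hx : x ∈ KRel π n) : (fun i => φ (x i)) ∈ KRel π' n := by
  rw [mem_KRel_iff _ hn] at hx ⊢
  refine ⟨fun i => ?_, ?_⟩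
  · rw [← MonoidHom.comp_apply, h, hx.1]
  · rw [← map_prod_ofFn]
    exact relComm_map_le φ h hx.2

/-- The map on `𝒦̃` induced by a homomorphism over `G`. -/
def KTilde.map (φ : F →* F') (h : π'.comp φ = π) {n : ℕ} (hn : 2 ≤ n) :
    KTilde π n →* KTilde π' n :=
  QuotientGroup.map _ _ (KGroup.map φ n) fun _ hx => KRel_map_mem φ h hn hx

theorem KTilde.map_mk (φ : F →* F') (h : π'.comp φ = π) {n : ℕ} (hn : 2 ≤ n) (x : KGroup F n) :
    KTilde.map φ h hn (QuotientGroup.mk x) = QuotientGroup.mk (KGroup.map φ n x) := rfl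

/-- The central extension `F / [F, N] → G` attached to `π : F → G`. -/
def centralQuot (π : F →* G) : F ⧸ relComm π →* G :=
  QuotientGroup.lift _ π (relComm_le_ker π)

theorem centralQuot_comp (π : F →* G) : (centralQuot π).comp (QuotientGroup.mk' _) = π := rfl

theorem centralQuot_surjective (hπ : Function.Surjective π) :
    Function.Surjective (centralQuot π) := fun g => by
  obtain ⟨x, rfl⟩ := hπ g
  exact ⟨QuotientGroup.mk' _ x, rfl⟩

theorem centralQuot_ker_le (π : F →* G) :
    (centralQuot π).ker ≤ Subgroup.center (F ⧸ relComm π) := by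
  intro x hx
  obtain ⟨x, rfl⟩ := QuotientGroup.mk'_surjective _ x
  exact mk_mem_center π hx

/-- Injectivity is the explicit description of the relations on both sides. Surjectivity holds
because `[F, N] ≤ [F, F]`, so any lift of a tuple of `𝒦` stays in `𝒦`. -/
theorem KTilde.bijective_map_mk (π : F →* G) {n : ℕ} (hn : 2 ≤ n) :
    Function.Bijective
      (KTilde.map (π' := centralQuot π) (QuotientGroup.mk' _) (centralQuot_comp π) hn) := by
  have hker := centralQuot_ker_le π
  constructor
  · rw [injective_iff_map_eq_one]
    intro x hx
    obtain ⟨x, rfl⟩ := QuotientGroup.mk_surjective x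
    rw [KTilde.map_mk, QuotientGroup.eq_one_iff, Subgroup.mem_subgroupOf,
      mem_KRel_iff_of_central _ hker hn] at hx
    rw [QuotientGroup.eq_one_iff, Subgroup.mem_subgroupOf, mem_KRel_iff _ hn]
    refine ⟨hx.1, ?_⟩
    rw [← QuotientGroup.ker_mk' (relComm π), MonoidHom.mem_ker, map_prod_ofFn]
    exact hx.2
  · intro y
    obtain ⟨⟨y, hy⟩, rfl⟩ := QuotientGroup.mk_surjective y
    choose x hx using fun i => QuotientGroup.mk'_surjective (relComm π) (y i)
    obtain rfl : (fun i => QuotientGroup.mk' (relComm π) (x i)) = y := funext hx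
    refine ⟨QuotientGroup.mk ⟨x, ?_⟩, rfl⟩
    rw [mem_KGroup_iff, ← map_prod_ofFn] at hy
    rw [mem_KGroup_iff]
    have h1 : commutator (F ⧸ relComm π) = (commutator F).map (QuotientGroup.mk' _) := by
      rw [commutator_def, commutator_def, Subgroup.map_commutator,
        Subgroup.map_top_of_surjective _ (QuotientGroup.mk'_surjective _)]
    rw [h1] at hy
    obtain ⟨z, hz, hzx⟩ := hy
    have h2 := QuotientGroup.eq.1 hzx
    have := mul_mem hz (relComm_le_commutator π h2)
    rwa [mul_inv_cancel_left] at this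

theorem hom_inv_mul_mem_ker (φ : F →* F) (h : π.comp φ = π) (x : F) : x⁻¹ * φ x ∈ π.ker := by
  rw [MonoidHom.mem_ker, map_mul, map_inv, ← MonoidHom.comp_apply, h, inv_mul_cancel]

/-- An endomorphism of a central extension of `G` over `G` differs from the identity by a
homomorphism into the centre. -/
def diffHom (hc : π.ker ≤ Subgroup.center F) (φ : F →* F) (h : π.comp φ = π) :
    F →* Subgroup.center F where
  toFun x := ⟨x⁻¹ * φ x, hc (hom_inv_mul_mem_ker φ h x)⟩
  map_one' := by simp
  map_mul' x y := by
    apply Subtype.ext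
    have := Subgroup.mem_center_iff.1 (hc (hom_inv_mul_mem_ker φ h x)) y⁻¹
    simp only [mul_inv_rev, map_mul, Subgroup.coe_mul]
    calc y⁻¹ * x⁻¹ * (φ x * φ y) = (y⁻¹ * (x⁻¹ * φ x)) * φ y := by group
      _ = _ := by rw [this]; group

theorem commutator_le_ker_diffHom (hc : π.ker ≤ Subgroup.center F) (φ : F →* F)
    (h : π.comp φ = π) : commutator F ≤ (diffHom hc φ h).ker :=
  commutator_le_ker_of_commute _ fun _ b => 
    Subtype.ext (Subgroup.mem_center_iff.1 (diffHom hc φ h b).2 _)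

theorem apply_eq_self_of_mem_commutator (hc : π.ker ≤ Subgroup.center F) (φ : F →* F)
    (h : π.comp φ = π) {x : F} (hx : x ∈ commutator F) : φ x = x := by
  have h1 := commutator_le_ker_diffHom hc φ h hx
  have h2 := congrArg Subtype.val (MonoidHom.mem_ker.1 h1)
  exact (inv_mul_eq_one.1 h2).symm

/-- The entries `xᵢ⁻¹ φ(xᵢ)` lie in the kernel, and their product is `diffHom` of the product of
`x`, which is trivial because that product is in the commutator subgroup. -/
theorem KTilde.map_eq_self (hc : π.ker ≤ Subgroup.center F) (φ : F →* F) (h : π.comp φ = π)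
    {n : ℕ} (hn : 2 ≤ n) (x : KTilde π n) : KTilde.map φ h hn x = x := by
  obtain ⟨⟨x, hx⟩, rfl⟩ := QuotientGroup.mk_surjective x
  rw [KTilde.map_mk, eq_comm, QuotientGroup.eq, Subgroup.mem_subgroupOf,
    mem_KRel_iff_of_central _ hc hn]
  refine ⟨fun i => hom_inv_mul_mem_ker φ h (x i), ?_⟩
  rw [mem_KGroup_iff] at hx
  have h1 := commutator_le_ker_diffHom hc φ h hx
  rw [MonoidHom.mem_ker, map_prod_ofFn] at h1
  have h2 := congrArg (Subgroup.center F).subtype h1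
  rw [map_prod_ofFn] at h2
  exact h2

/-- Central extensions of `G` which map to each other over `G` have the same `𝒦̃`. -/
def KTilde.equiv (hc : π.ker ≤ Subgroup.center F) (hc' : π'.ker ≤ Subgroup.center F')
    (φ : F →* F') (hφ : π'.comp φ = π) (ψ : F' →* F) (hψ : π.comp ψ = π') {n : ℕ} (hn : 2 ≤ n) :
    KTilde π n ≃* KTilde π' n :=
  MonoidHom.toMulEquiv (KTilde.map φ hφ hn) (KTilde.map ψ hψ hn)
    (by
      ext x
      refine KTilde.map_eq_self hc (ψ.comp φ) (by rw [← MonoidHom.comp_assoc, hψ, hφ]) hn (QuotientGroup.mk x))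
    (by
      ext x
      refine KTilde.map_eq_self hc' (φ.comp ψ) (by rw [← MonoidHom.comp_assoc, hφ, hψ]) hn (QuotientGroup.mk x))

end Functoriality

/-! ### Lifting from the free presentation -/

section Free

variable {F : Type v} {G : Type u} {X : Type w} [Group F] [Group G] [Group X]

/-- `F / [F, N] → G` maps over `G` to every central extension of `G`. -/
theorem exists_lift_centralQuot [IsFreeGroup F] (π : F →* G) (q : X →* G)
    (hq : Function.Surjective q) (hc : q.ker ≤ Subgroup.center X) :
    ∃ φ : F ⧸ relComm π →* X, q.comp φ = centralQuot π := by
  choose s hs using hq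
  let φ : F →* X := IsFreeGroup.lift fun a => s (π (IsFreeGroup.of a))
  have hφ : q.comp φ = π := by
    refine IsFreeGroup.ext_hom fun a => ?_
    simp [φ, IsFreeGroup.lift_of, hs]
  have h1 : relComm π ≤ φ.ker := by
    intro x hx
    have := relComm_map_le φ hφ hx
    rw [relComm_eq_bot q hc] at this
    exact this
  refine ⟨QuotientGroup.lift _ φ h1, ?_⟩
  refine QuotientGroup.monoidHom_ext _ ?_
  exact hφ

end Free

/-! ### The centre of `𝒦̃` for a central extension of an abelian group -/

section Centre

variable {E : Type v} {G : Type u} [Group E] [CommGroup G] {q : E →* G}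

theorem commutator_le_ker (q : E →* G) : commutator E ≤ q.ker :=
  Abelianization.commutator_subset_ker q

/-- For a central extension of an abelian group, `x ↦ [e, x]` is a homomorphism. -/
def commutatorHom (hc : q.ker ≤ Subgroup.center E) (e : E) : E →* E where
  toFun x := ⁅e, x⁆
  map_one' := commutatorElement_one_right e
  map_mul' x y := by
    have h : ⁅e, y⁆ ∈ Subgroup.center E :=
      hc (commutator_le_ker q (Subgroup.commutator_mem_commutator trivial trivial))
    have h1 := Subgroup.mem_center_iff.1 h x
    calc ⁅e, x * y⁆ = ⁅e, x⁆ * (x * ⁅e, y⁆ * x⁻¹) := by simp only [commutatorElement_def]; group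
      _ = _ := by rw [h1]; group

theorem commutatorHom_apply (hc : q.ker ≤ Subgroup.center E) (e x : E) :
    commutatorHom hc e x = ⁅e, x⁆ := rfl

theorem commutatorElement_mem_center (hc : q.ker ≤ Subgroup.center E) (e x : E) :
    ⁅e, x⁆ ∈ Subgroup.center E :=
  hc (commutator_le_ker q (Subgroup.commutator_mem_commutator trivial trivial))

theorem prod_apply_eq_one {n : ℕ} (q : E →* G) (x : KGroup E n) : ∏ i, q (x.1 i) = 1 := by
  have := commutator_le_ker q (mem_KGroup_iff.1 x.2)
  rwa [MonoidHom.mem_ker, map_prod_ofFn, List.prod_ofFn] at this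

theorem mem_center_of_apply_mem (hc : q.ker ≤ Subgroup.center E) {x : E}
    (h : q x ∈ (Subgroup.center E).map q) : x ∈ Subgroup.center E := by
  obtain ⟨z, hz, hzx⟩ := h
  have : z⁻¹ * x ∈ q.ker := by rw [MonoidHom.mem_ker, map_mul, map_inv, hzx, inv_mul_cancel]
  simpa using mul_mem hz (hc this)

/-- The subgroup of `𝒦(E, n)` of tuples of central elements. -/
def centralTuples (E : Type v) [Group E] (n : ℕ) : Subgroup (KGroup E n) where
  carrier := {x | ∀ i, x.1 i ∈ Subgroup.center E}
  one_mem' _ := one_mem _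
  mul_mem' ha hb i := mul_mem (ha i) (hb i)
  inv_mem' ha i := inv_mem (ha i)

/-- Centrality is tested on tuples with `e` at `i` and `e⁻¹` at `j`. The hypothesis `hpow` is where
coprimality of `n` and `p` will enter. -/
theorem mk_mem_center_iff (hc : q.ker ≤ Subgroup.center E) {n : ℕ} (hn : 2 ≤ n)
    (hpow : ∀ g : G, g ^ n ∈ (Subgroup.center E).map q → g ∈ (Subgroup.center E).map q)
    (x : KGroup E n) :
    (QuotientGroup.mk x : KTilde q n) ∈ Subgroup.center (KTilde q n) ↔
      x ∈ centralTuples E n := by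
  constructor
  · intro h
    have key : ∀ i j (e : E), i ≠ j → ⁅e, x.1 i⁆ = ⁅e, x.1 j⁆ := by
      intro i j e hij
      have hy : (Pi.mulSingle i e * Pi.mulSingle j e⁻¹ : Fin n → E) ∈ KGroup E n := by
        rw [KGroup, MonoidHom.mem_ker, map_mul, psiHom_mulSingle, psiHom_mulSingle, map_inv,
          mul_inv_cancel]
      have h1 := Subgroup.mem_center_iff.1 h (QuotientGroup.mk ⟨_, hy⟩)
      rw [← QuotientGroup.mk_mul, ← QuotientGroup.mk_mul, eq_comm, QuotientGroup.eq,
        Subgroup.mem_subgroupOf, mem_KRel_iff_of_central _ hc hn] at h1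
      -- The two orders of multiplication differ only at places `i` and `j`; bimultiplicativity
      -- turns the product of these entries into `⁅e, xᵢ⁆ ⁅e, xⱼ⁆⁻¹`.
      have h2 : ((x * ⟨_, hy⟩)⁻¹ * (⟨_, hy⟩ * x) : KGroup E n).1 =
          Pi.mulSingle i ⁅e⁻¹, (x.1 i)⁻¹⁆ * Pi.mulSingle j ⁅e, (x.1 j)⁻¹⁆ := by
        funext k
        change (x.1 k * ((Pi.mulSingle i e : Fin n → E) k * (Pi.mulSingle j e⁻¹ : Fin n → E) k))⁻¹ *
          (((Pi.mulSingle i e : Fin n → E) k * (Pi.mulSingle j e⁻¹ : Fin n → E) k) * x.1 k) =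
          (Pi.mulSingle i ⁅e⁻¹, (x.1 i)⁻¹⁆ : Fin n → E) k *
            (Pi.mulSingle j ⁅e, (x.1 j)⁻¹⁆ : Fin n → E) k
        by_cases hki : k = i
        · subst hki
          simp only [Pi.mulSingle_eq_same, Pi.mulSingle_eq_of_ne hij, commutatorElement_def]
          group
        · by_cases hkj : k = j
          · subst hkj
            simp only [Pi.mulSingle_eq_same, Pi.mulSingle_eq_of_ne hki, commutatorElement_def]
            group
          · simp [Pi.mulSingle_eq_of_ne hki, Pi.mulSingle_eq_of_ne hkj]
      have h3 := h1.2
      change (List.ofFn ((x * ⟨_, hy⟩)⁻¹ * (⟨_, hy⟩ * x) : KGroup E n).1).prod = 1 at h3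
      rw [h2, prod_ofFn_mul_of_mem_center, prod_ofFn_mulSingle, prod_ofFn_mulSingle] at h3
      · have h4 : ⁅e⁻¹, (x.1 i)⁻¹⁆ = ⁅e, x.1 i⁆ := by
          rw [← commutatorHom_apply hc, map_inv, commutatorHom_apply, commutatorElement_inv,
            ← commutatorHom_apply hc, map_inv, commutatorHom_apply, commutatorElement_inv]
        rw [h4, ← commutatorHom_apply hc e, ← commutatorHom_apply hc e, map_inv,
          mul_inv_eq_one] at h3
        exact h3
      · intro k
        by_cases hkj : k = j
        · subst hkj
          rw [Pi.mulSingle_eq_same]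
          exact commutatorElement_mem_center hc _ _
        · rw [Pi.mulSingle_eq_of_ne hkj]
          exact one_mem _
    have key2 : ∀ i j, x.1 i * (x.1 j)⁻¹ ∈ Subgroup.center E := by
      intro i j
      rcases eq_or_ne i j with rfl | hij
      · simp
      rw [Subgroup.mem_center_iff]
      intro e
      rw [← commutatorElement_eq_one_iff_mul_comm, ← commutatorHom_apply hc, map_mul, map_inv,
        mul_inv_eq_one]
      exact key i j e hij
    intro j
    refine mem_center_of_apply_mem hc (hpow _ ?_)
    -- The `q (x i)` multiply to `1`, so only the `n` copies of `q (x j)⁻¹` survive.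
    have h5 : ∏ i, q (x.1 i * (x.1 j)⁻¹) = (q (x.1 j) ^ n)⁻¹ := by
      simp only [map_mul, map_inv, Finset.prod_mul_distrib, prod_apply_eq_one]
      simp
    rw [← inv_mem_iff, ← h5]
    exact Subgroup.prod_mem _ fun i _ => Subgroup.mem_map_of_mem _ (key2 i j)
  · intro h
    rw [Subgroup.mem_center_iff]
    intro y
    obtain ⟨y, rfl⟩ := QuotientGroup.mk_surjective y
    rw [← QuotientGroup.mk_mul, ← QuotientGroup.mk_mul]
    congr 1
    exact Subtype.ext (funext fun i => Subgroup.mem_center_iff.1 (h i) _)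

/-- The map `x ↦ (x₁ ⋯ xₙ, (q x₁, …, q xₙ))` on tuples of central elements. -/
def centralTuplesHom (q : E →* G) (n : ℕ) :
    centralTuples E n →* commutator E × KGroup ((Subgroup.center E).map q) n :=
  MonoidHom.mk' (fun x => (⟨(List.ofFn x.1.1).prod, mem_KGroup_iff.1 x.1.2⟩,
    ⟨fun i => ⟨q (x.1.1 i), Subgroup.mem_map_of_mem _ (x.2 i)⟩, by
      have h : ∏ i, (⟨q (x.1.1 i), Subgroup.mem_map_of_mem _ (x.2 i)⟩ :
          (Subgroup.center E).map q) = 1 := by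
        apply Subtype.ext
        rw [Subgroup.val_finsetProd]
        exact prod_apply_eq_one q x.1
      rw [mem_KGroup_iff, List.prod_ofFn, h]
      exact one_mem _⟩)) fun x y => by
    refine Prod.ext (Subtype.ext ?_) (Subtype.ext (funext fun i => Subtype.ext ?_))
    · exact prod_ofFn_mul_of_mem_center _ _ y.2
    · exact map_mul q _ _

/-- Central lifts `b` of the second component have some product `c`. Multiplying one entry by `c⁻¹ *
h`, an element of the kernel, corrects the product without changing the images in `G`. -/
theorem centralTuplesHom_surjective (hc : q.ker ≤ Subgroup.center E) {n : ℕ} (hn : 0 < n) :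
    Function.Surjective (centralTuplesHom q n) := by
  rintro ⟨⟨h, hh⟩, ⟨z, hz⟩⟩
  choose b hb hbz using fun i => (z i).2
  have hcom := commutator_le_ker q hh
  set c := (List.ofFn b).prod with hcdef
  have hcker : c ∈ q.ker := by
    rw [mem_KGroup_iff, List.prod_ofFn] at hz
    have hz1 := commutator_le_ker ((Subgroup.center E).map q).subtype hz
    rw [MonoidHom.mem_ker, map_prod] at hz1
    rw [MonoidHom.mem_ker, hcdef, map_prod_ofFn, List.prod_ofFn, ← hz1]
    exact Finset.prod_congr rfl fun i _ => hbz i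
  have hd : c⁻¹ * h ∈ q.ker := mul_mem (inv_mem hcker) hcom
  have hdc : ∀ i, (Pi.mulSingle (⟨0, hn⟩ : Fin n) (c⁻¹ * h) : Fin n → E) i ∈ q.ker := by
    intro i
    by_cases hi : i = ⟨0, hn⟩
    · subst hi
      rwa [Pi.mulSingle_eq_same]
    · rw [Pi.mulSingle_eq_of_ne hi]
      exact one_mem _
  have hprod : (List.ofFn (b * Pi.mulSingle (⟨0, hn⟩ : Fin n) (c⁻¹ * h))).prod = h := by
    rw [prod_ofFn_mul_of_mem_center _ _ fun i => hc (hdc i), prod_ofFn_mulSingle, ← hcdef,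
      mul_inv_cancel_left]
  refine ⟨⟨⟨b * Pi.mulSingle (⟨0, hn⟩ : Fin n) (c⁻¹ * h), ?_⟩, ?_⟩, ?_⟩
  · rw [mem_KGroup_iff, hprod]
    exact hh
  · exact fun i => mul_mem (hb i) (hc (hdc i))
  · refine Prod.ext (Subtype.ext hprod) (Subtype.ext (funext fun i => Subtype.ext ?_))
    change q (b i * _) = z i
    rw [map_mul, MonoidHom.mem_ker.1 (hdc i), mul_one]
    exact hbz i

theorem centralTuplesHom_ker (hc : q.ker ≤ Subgroup.center E) {n : ℕ} (hn : 2 ≤ n) :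
    (centralTuplesHom q n).ker =
      ((QuotientGroup.mk' ((KRel q n).subgroupOf (KGroup E n))).subgroupMap
        (centralTuples E n)).ker := by
  ext x
  have h1 : x ∈ ((QuotientGroup.mk' ((KRel q n).subgroupOf (KGroup E n))).subgroupMap
      (centralTuples E n)).ker ↔ x.1.1 ∈ KRel q n := by
    rw [MonoidHom.mem_ker, ← Subgroup.mem_subgroupOf, ← QuotientGroup.eq_one_iff]
    exact Subtype.ext_iff
  rw [h1, mem_KRel_iff_of_central _ hc hn, MonoidHom.mem_ker, Prod.ext_iff, Subtype.ext_iff,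
    Subtype.ext_iff, and_comm, funext_iff]
  refine and_congr (forall_congr' fun i => ?_) Iff.rfl
  exact Subtype.ext_iff

theorem nonempty_center_mulEquiv (hc : q.ker ≤ Subgroup.center E) {n : ℕ} (hn : 2 ≤ n)
    (hpow : ∀ g : G, g ^ n ∈ (Subgroup.center E).map q → g ∈ (Subgroup.center E).map q) :
    Nonempty (Subgroup.center (KTilde q n) ≃*
      commutator E × KGroup ((Subgroup.center E).map q) n) := by
  have hcenter : (centralTuples E n).map (QuotientGroup.mk' ((KRel q n).subgroupOf (KGroup E n))) =
      Subgroup.center (KTilde q n) := by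
    ext y
    obtain ⟨y, rfl⟩ := QuotientGroup.mk_surjective y
    rw [mk_mem_center_iff hc hn hpow]
    constructor
    · rintro ⟨x, hx, hxy⟩
      rw [← mk_mem_center_iff hc hn hpow, ← hxy]
      exact (mk_mem_center_iff hc hn hpow x).2 hx
    · intro h
      exact ⟨y, h, rfl⟩
  exact ⟨(MulEquiv.subgroupCongr hcenter).symm.trans
    ((QuotientGroup.quotientKerEquivOfSurjective _
      (MonoidHom.subgroupMap_surjective _ _)).symm.trans
    ((QuotientGroup.quotientMulEquivOfEq (centralTuplesHom_ker hc hn).symm).trans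
      (QuotientGroup.quotientKerEquivOfSurjective _
        (centralTuplesHom_surjective hc (by omega)))))⟩

end Centre

/-! ### Splitting off a direct factor `G` -/

/-- A surjection onto a finite abelian group splits by a homomorphism with central values as soon
as elements lift to central elements of the same order. -/
theorem exists_central_section {T : Type v} {G : Type u} [Group T] [CommGroup G] [Finite G]
    (h : T →* G)
    (hlift : ∀ g : G, ∃ t ∈ Subgroup.center T, h t = g ∧ t ^ orderOf g = 1) :
    ∃ θ : G →* T, (∀ g, θ g ∈ Subgroup.center T) ∧ ∀ g, h (θ g) = g := by
  classical
  obtain ⟨ι, _, n, -, ⟨f⟩⟩ := CommGroup.equiv_prod_multiplicative_zmod_of_finite G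
  let b : (i : ι) → Multiplicative (ZMod (n i)) →* G := fun i =>
    f.symm.toMonoidHom.comp (MonoidHom.mulSingle (fun i => Multiplicative (ZMod (n i))) i)
  choose t htc hth hto using fun i => hlift (b i (Multiplicative.ofAdd 1))
  -- The order of the lift divides that of the basis element, which divides `n i`; so `t i` defines
  -- a homomorphism on the `i`-th cyclic factor.
  have hpow : ∀ i, t i ^ n i = 1 := by
    intro i
    refine orderOf_dvd_iff_pow_eq_one.1 ((orderOf_dvd_of_pow_eq_one (hto i)).trans ?_)
    refine orderOf_dvd_of_pow_eq_one ?_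
    rw [← map_pow, ← ofAdd_nsmul]
    simp
  let φ : (i : ι) → Multiplicative (ZMod (n i)) →* T := fun i =>
    AddMonoidHom.toMultiplicativeLeft (ZMod.lift (n i)
      ⟨(zmultiplesHom (Additive T)) (Additive.ofMul (t i)), by
        simpa using congrArg Additive.ofMul (hpow i)⟩)
  have hφ : ∀ i (k : ℤ), φ i (Multiplicative.ofAdd (k : ZMod (n i))) = t i ^ k := by
    intro i k
    simp [φ]
  have hφc : ∀ i x, φ i x ∈ Subgroup.center T := by
    intro i x
    obtain ⟨k, hk⟩ := ZMod.intCast_surjective x.toAdd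
    obtain rfl : Multiplicative.ofAdd (k : ZMod (n i)) = x := by rw [hk]; rfl
    rw [hφ]
    exact zpow_mem (htc i) k
  have hφh : ∀ i x, h (φ i x) = b i x := by
    intro i x
    obtain ⟨k, hk⟩ := ZMod.intCast_surjective x.toAdd
    obtain rfl : Multiplicative.ofAdd (k : ZMod (n i)) = x := by rw [hk]; rfl
    rw [hφ, map_zpow, hth, ← map_zpow, ← ofAdd_zsmul]
    simp
  have hcomm : Pairwise fun i j => ∀ x y, Commute (φ i x) (φ j y) := fun i j _ x y =>
    Subgroup.mem_center_iff.1 (hφc j y) _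
  let Θ := MonoidHom.noncommPiCoprod φ hcomm
  have hΘ : (h.comp Θ).comp f.toMonoidHom = MonoidHom.id G := by
    have : h.comp Θ = f.symm.toMonoidHom := by
      refine MonoidHom.functions_ext _ _ _ fun i x => ?_
      simp only [MonoidHom.comp_apply, Θ, MonoidHom.noncommPiCoprod_mulSingle, hφh]
      rfl
    ext g
    rw [this]
    simp
  refine ⟨Θ.comp f.toMonoidHom, fun g => ?_, fun g => DFunLike.congr_fun hΘ g⟩
  have h1 : Θ.range ≤ Subgroup.center T := by
    rw [MonoidHom.noncommPiCoprod_range]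
    refine iSup_le fun i => ?_
    rintro _ ⟨x, rfl⟩
    exact hφc i x
  exact h1 ⟨_, rfl⟩

section Split

variable {E : Type v} {G : Type u} [Group E] [CommGroup G] {q : E →* G}

theorem prod_ofFn_cons {n : ℕ} (a : E) (x : Fin n → E) :
    (List.ofFn (Fin.cons a x : Fin (n + 1) → E)).prod = a * (List.ofFn x).prod := by
  rw [List.ofFn_succ, List.prod_cons]
  rfl

/-- The inclusion `𝒦(E, m) → 𝒦(E, m + 1)`, `x ↦ (1, x)`. -/
def KGroup.consOne (E : Type v) [Group E] (m : ℕ) : KGroup E m →* KGroup E (m + 1) :=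
  MonoidHom.mk' (fun x => ⟨Fin.cons 1 x.1, by
    rw [mem_KGroup_iff, prod_ofFn_cons, one_mul]
    exact mem_KGroup_iff.1 x.2⟩) fun x y => by
    refine Subtype.ext (funext fun i => ?_)
    refine Fin.cases ?_ (fun i => ?_) i
    · exact (one_mul 1).symm
    · rfl

theorem consOne_mem_KRel_iff (hc : q.ker ≤ Subgroup.center E) {m : ℕ} (hm : 2 ≤ m)
    (x : KGroup E m) : (KGroup.consOne E m x).1 ∈ KRel q (m + 1) ↔ x.1 ∈ KRel q m := by
  rw [mem_KRel_iff_of_central _ hc hm, mem_KRel_iff_of_central _ hc (by omega)]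
  change (∀ i, q ((Fin.cons 1 x.1 : Fin (m + 1) → E) i) = 1) ∧
    (List.ofFn (Fin.cons 1 x.1 : Fin (m + 1) → E)).prod = 1 ↔ _
  rw [prod_ofFn_cons, one_mul, Fin.forall_fin_succ]
  simp

/-- The map `𝒦̃(m) → 𝒦̃(m + 1)` induced by `x ↦ (1, x)`. -/
def KTilde.consOne (hc : q.ker ≤ Subgroup.center E) {m : ℕ} (hm : 2 ≤ m) :
    KTilde q m →* KTilde q (m + 1) :=
  QuotientGroup.map _ _ (KGroup.consOne E m) fun x hx => (consOne_mem_KRel_iff hc hm x).2 hx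

theorem KTilde.consOne_injective (hc : q.ker ≤ Subgroup.center E) {m : ℕ} (hm : 2 ≤ m) :
    Function.Injective (KTilde.consOne hc hm) := by
  rw [injective_iff_map_eq_one]
  intro x hx
  obtain ⟨x, rfl⟩ := QuotientGroup.mk_surjective x
  rw [QuotientGroup.eq_one_iff, Subgroup.mem_subgroupOf, ← consOne_mem_KRel_iff hc hm]
  exact (QuotientGroup.eq_one_iff (N := (KRel q (m + 1)).subgroupOf (KGroup E (m + 1)))
    (KGroup.consOne E m x)).1 hx

/-- The first coordinate `𝒦̃ → G`. -/
def KTilde.head (q : E →* G) (m : ℕ) : KTilde q (m + 1) →* G :=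
  QuotientGroup.lift _
    ((q.comp (Pi.evalMonoidHom (fun _ : Fin (m + 1) => E) 0)).comp (KGroup E (m + 1)).subtype)
    fun _ hx => (ker_and_prod_of_mem_KRel q hx).1 0

theorem KTilde.head_mk (q : E →* G) (m : ℕ) (x : KGroup E (m + 1)) :
    KTilde.head q m (QuotientGroup.mk x) = q (x.1 0) := rfl

theorem KTilde.head_consOne (hc : q.ker ≤ Subgroup.center E) {m : ℕ} (hm : 2 ≤ m)
    (x : KTilde q m) : KTilde.head q m (KTilde.consOne hc hm x) = 1 := by
  obtain ⟨x, rfl⟩ := QuotientGroup.mk_surjective x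
  exact map_one q

/-- When `y 0` lies in the kernel it is central, and it can be moved into the next coordinate
without changing the product or the images in `G`. -/
theorem KTilde.exists_consOne_eq (hc : q.ker ≤ Subgroup.center E) {m : ℕ} (hm : 2 ≤ m)
    (y : KTilde q (m + 1)) (hy : KTilde.head q m y = 1) : ∃ x, KTilde.consOne hc hm x = y := by
  obtain ⟨⟨y, hyK⟩, rfl⟩ := QuotientGroup.mk_surjective y
  rw [KTilde.head_mk] at hy
  have hy0 : y 0 ∈ Subgroup.center E := hc hy
  have h0 : 0 < m := by omega
  set a : Fin m → E := Pi.mulSingle ⟨0, h0⟩ (y 0) with ha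
  have haker : ∀ i, a i ∈ q.ker := by
    intro i
    by_cases hi : i = ⟨0, h0⟩
    · rw [hi, ha, Pi.mulSingle_eq_same]
      exact hy
    · rw [ha, Pi.mulSingle_eq_of_ne hi]
      exact one_mem _
  have hprod : (List.ofFn (Fin.tail y * a)).prod = (List.ofFn y).prod := by
    rw [prod_ofFn_mul_of_mem_center _ _ fun i => hc (haker i), prod_ofFn_mulSingle,
      ← Fin.cons_self_tail y, prod_ofFn_cons, Fin.cons_self_tail y]
    exact Subgroup.mem_center_iff.1 hy0 _
  have hK : Fin.tail y * a ∈ KGroup E m := by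
    rw [mem_KGroup_iff, hprod]
    exact mem_KGroup_iff.1 hyK
  refine ⟨QuotientGroup.mk ⟨_, hK⟩, ?_⟩
  change QuotientGroup.mk (KGroup.consOne E m ⟨_, hK⟩) = _
  rw [QuotientGroup.eq, Subgroup.mem_subgroupOf, mem_KRel_iff_of_central _ hc (by omega)]
  set d : Fin (m + 1) → E :=
    ((KGroup.consOne E m ⟨_, hK⟩)⁻¹ * ⟨y, hyK⟩ : KGroup E (m + 1)).1 with hd
  have hdker : ∀ i, q (d i) = 1 := by
    intro i
    refine Fin.cases ?_ (fun i => ?_) i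
    · change q (1⁻¹ * y 0) = 1
      simpa using hy
    · change q ((y i.succ * a i)⁻¹ * y i.succ) = 1
      simp [MonoidHom.mem_ker.1 (haker i)]
  refine ⟨hdker, ?_⟩
  have h1 := prod_ofFn_mul_of_mem_center (KGroup.consOne E m ⟨_, hK⟩).1 d fun i => hc (hdker i)
  have h2 : (KGroup.consOne E m ⟨_, hK⟩).1 * d = y := mul_inv_cancel_left _ _
  have h3 : (List.ofFn (KGroup.consOne E m ⟨_, hK⟩).1).prod = (List.ofFn y).prod := by
    rw [← hprod]
    exact (prod_ofFn_cons _ _).trans (one_mul _)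
  rw [h2, h3] at h1
  exact (mul_eq_left.1 h1.symm)

/-- The tuple `(e⁻ᵐ, e, …, e)` of `𝒦(E, m + 1)`. -/
def diagTuple (m : ℕ) (e : E) : KGroup E (m + 1) :=
  ⟨Fin.cons (e ^ m)⁻¹ fun _ => e, by
    rw [mem_KGroup_iff, prod_ofFn_cons, List.ofFn_const, List.prod_replicate, inv_mul_cancel]
    exact one_mem _⟩

theorem diagTuple_pow (m k : ℕ) (e : E) : diagTuple m e ^ k = diagTuple m (e ^ k) := by
  refine Subtype.ext (funext fun i => ?_)
  refine Fin.cases ?_ (fun i => ?_) i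
  · change ((e ^ m)⁻¹) ^ k = ((e ^ k) ^ m)⁻¹
    rw [inv_pow, ← pow_mul, ← pow_mul, mul_comm]
  · rfl

theorem mk_diagTuple_eq_one (hc : q.ker ≤ Subgroup.center E) {m : ℕ} (hm : 2 ≤ m) {e : E}
    (he : e ∈ q.ker) : (QuotientGroup.mk (diagTuple m e) : KTilde q (m + 1)) = 1 := by
  rw [QuotientGroup.eq_one_iff, Subgroup.mem_subgroupOf,
    mem_KRel_iff_of_central _ hc (by omega)]
  refine ⟨fun i => ?_, ?_⟩
  · refine Fin.cases ?_ (fun i => he) i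
    change q (e ^ m)⁻¹ = 1
    rw [map_inv, map_pow, MonoidHom.mem_ker.1 he, one_pow, inv_one]
  · refine (prod_ofFn_cons _ _).trans ?_
    rw [List.ofFn_const, List.prod_replicate, inv_mul_cancel]

/-- Modulo the central element `e ^ (m + 1)` all entries of the tuple are `e`. Its commutator with
`y` therefore has product `⁅e, y₀ ⋯ yₘ⁆` up to inversion, which vanishes since `y₀ ⋯ yₘ ∈ [E, E]` is
central. -/
theorem mk_diagTuple_mem_center (hc : q.ker ≤ Subgroup.center E) {m : ℕ} (hm : 2 ≤ m) {e : E}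
    (he : e ^ (m + 1) ∈ q.ker) :
    (QuotientGroup.mk (diagTuple m e) : KTilde q (m + 1)) ∈ Subgroup.center _ := by
  rw [Subgroup.mem_center_iff]
  intro y
  obtain ⟨⟨y, hy⟩, rfl⟩ := QuotientGroup.mk_surjective y
  rw [← QuotientGroup.mk_mul, ← QuotientGroup.mk_mul, QuotientGroup.eq, Subgroup.mem_subgroupOf,
    mem_KRel_iff_of_central _ hc (by omega)]
  have hcomm : (((⟨y, hy⟩ : KGroup E (m + 1)) * diagTuple m e)⁻¹ *
      (diagTuple m e * ⟨y, hy⟩)).1 = fun i => commutatorHom hc e⁻¹ ((y i)⁻¹) := by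
    funext i
    refine Fin.cases ?_ (fun i => ?_) i
    · change (y 0 * (e ^ m)⁻¹)⁻¹ * ((e ^ m)⁻¹ * y 0) = commutatorHom hc e⁻¹ ((y 0)⁻¹)
      have h1 := Subgroup.mem_center_iff.1 (hc he) (y 0)
      have h2 : (e ^ m)⁻¹ = e * (e ^ (m + 1))⁻¹ := by rw [pow_succ']; group
      have h3 : (e ^ (m + 1))⁻¹ * y 0 = y 0 * (e ^ (m + 1))⁻¹ := by
        rw [inv_mul_eq_iff_eq_mul, ← mul_assoc, ← h1, mul_inv_cancel_right]
      rw [h2, mul_assoc e, h3, commutatorHom_apply, commutatorElement_def]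
      have h4 : e * (e ^ (m + 1))⁻¹ = (e ^ (m + 1))⁻¹ * e := by
        rw [pow_succ']; group
      have h5 := Subgroup.mem_center_iff.1 (inv_mem (hc he))
      generalize (e ^ (m + 1))⁻¹ = z at *
      have h6 : (y 0 * (e * z))⁻¹ * (e * (y 0 * z)) =
        z⁻¹ * (e⁻¹ * (y 0)⁻¹ * e * y 0 * z) := by group
      rw [h6, h5, inv_mul_cancel_left]
      group
    · change (y i.succ * e)⁻¹ * (e * y i.succ) = _
      rw [commutatorHom_apply, commutatorElement_def]
      group
  rw [hcomm]
  refine ⟨fun i => ?_, ?_⟩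
  · exact commutator_le_ker q (Subgroup.commutator_mem_commutator trivial trivial)
  · rw [show (fun i => commutatorHom hc e⁻¹ (y i)⁻¹) = (fun i => commutatorHom hc e⁻¹ (y i))⁻¹ from
      funext fun i => map_inv _ _, prod_ofFn_inv_of_mem_center (fun i => commutatorHom hc e⁻¹ (y i))
        (fun i => commutatorElement_mem_center hc _ _), inv_eq_one, ← map_prod_ofFn]
    have h1 := hc (commutator_le_ker q (mem_KGroup_iff.1 hy))
    rw [commutatorHom_apply, commutatorElement_eq_one_iff_mul_comm]
    exact Subgroup.mem_center_iff.1 h1 _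

theorem nonempty_mulEquiv_prod [Finite G] (hc : q.ker ≤ Subgroup.center E)
    (hq : Function.Surjective q) {m : ℕ} (hm : 2 ≤ m) (hexp : Monoid.exponent G ∣ m + 1) :
    Nonempty (KTilde q (m + 1) ≃* G × KTilde q m) := by
  obtain ⟨θ, hθc, hθ⟩ := exists_central_section (KTilde.head q m) fun g => by
    obtain ⟨e, rfl⟩ := hq g
    have hpow : ∀ g : G, g ^ (m + 1) = 1 := fun g =>
      orderOf_dvd_iff_pow_eq_one.1 ((Monoid.order_dvd_exponent g).trans hexp)
    refine ⟨QuotientGroup.mk (diagTuple m e), mk_diagTuple_mem_center hc hm ?_, ?_, ?_⟩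
    · rw [MonoidHom.mem_ker, map_pow, hpow]
    · rw [KTilde.head_mk]
      -- The first entry is `e⁻ᵐ` precisely so that its image is `q e`, as `(q e) ^ (m + 1) = 1`.
      change q (e ^ m)⁻¹ = _
      rw [map_inv, map_pow, inv_eq_iff_mul_eq_one, ← pow_succ, hpow]
    · rw [← QuotientGroup.mk_pow, diagTuple_pow]
      refine mk_diagTuple_eq_one hc hm ?_
      rw [MonoidHom.mem_ker, map_pow, pow_orderOf_eq_one]
  let Φ : G × KTilde q m →* KTilde q (m + 1) :=
    MonoidHom.noncommCoprod θ (KTilde.consOne hc hm) fun g x =>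
      (Subgroup.mem_center_iff.1 (hθc g) _).symm
  have hΦ : ∀ g x, Φ (g, x) = θ g * KTilde.consOne hc hm x := fun g x => rfl
  refine ⟨(MulEquiv.ofBijective Φ ⟨?_, ?_⟩).symm⟩
  · rw [injective_iff_map_eq_one]
    rintro ⟨g, x⟩ h
    rw [hΦ] at h
    have h1 := congrArg (KTilde.head q m) h
    rw [map_mul, hθ, KTilde.head_consOne, mul_one, map_one] at h1
    subst h1
    rw [map_one, one_mul] at h
    rw [(injective_iff_map_eq_one _).1 (KTilde.consOne_injective hc hm) x h]
    rfl
  · intro y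
    obtain ⟨x, hx⟩ := KTilde.exists_consOne_eq hc hm ((θ (KTilde.head q m y))⁻¹ * y) (by
      rw [map_mul, map_inv, hθ, inv_mul_cancel])
    exact ⟨(KTilde.head q m y, x), by rw [hΦ, hx, mul_inv_cancel_left]⟩

end Split

/-! ### Central extensions from factor sets -/

section CocycleExtension

open scoped IsMulCommutative

/-- The cocycle identity for a map `G × G → T` with trivial action of `G` on `T`. -/
def IsTrivialCocycle {G : Type u} {T : Type w} [Group G] [AddCommGroup T] (f : G → G → T) : Prop :=
  ∀ g h j, f g h + f (g * h) j = f h j + f g (h * j)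

variable {G : Type u} {T : Type w} [Group G] [AddCommGroup T] {f : G → G → T}

theorem IsTrivialCocycle.one_left (hf : IsTrivialCocycle f) (g : G) : f 1 g = f 1 1 := by
  have := hf 1 1 g
  simp only [one_mul, mul_one] at this
  exact (add_right_cancel this).symm

theorem IsTrivialCocycle.one_right (hf : IsTrivialCocycle f) (g : G) : f g 1 = f 1 1 := by
  have := hf g 1 1
  simp only [mul_one] at this
  exact add_right_cancel this

/-- The central extension of `G` by `T` with a given factor set. -/
@[ext]
structure CocycleExt (hf : IsTrivialCocycle f) where
  /-- The component in the kernel. -/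
  left : T
  /-- The component in the quotient. -/
  right : G

variable {hf : IsTrivialCocycle f}

namespace CocycleExt

instance : Mul (CocycleExt hf) := ⟨fun x y => ⟨x.left + y.left + f x.right y.right, x.right * y.right⟩⟩

/-- Factor sets are not assumed normalised, hence the correction by `f 1 1` here, in the inverse and
in `incl`. -/
instance : One (CocycleExt hf) := ⟨⟨-f 1 1, 1⟩⟩

instance : Inv (CocycleExt hf) := ⟨fun x => ⟨-x.left - f x.right⁻¹ x.right - f 1 1, x.right⁻¹⟩⟩

theorem mul_def (x y : CocycleExt hf) :
    x * y = ⟨x.left + y.left + f x.right y.right, x.right * y.right⟩ := rfl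

theorem one_def : (1 : CocycleExt hf) = ⟨-f 1 1, 1⟩ := rfl

theorem inv_def (x : CocycleExt hf) :
    x⁻¹ = ⟨-x.left - f x.right⁻¹ x.right - f 1 1, x.right⁻¹⟩ := rfl

instance : Group (CocycleExt hf) :=
  Group.ofLeftAxioms
    (fun x y z => by
      refine CocycleExt.ext ?_ (mul_assoc _ _ _)
      have := hf x.right y.right z.right
      simp only [mul_def]
      calc _ = x.left + y.left + z.left +
            (f x.right y.right + f (x.right * y.right) z.right) := by abel
        _ = _ := by rw [this]; abel)
    (fun x => by
      refine CocycleExt.ext ?_ (one_mul _)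
      simp only [mul_def, one_def, hf.one_left]
      abel)
    (fun x => by
      refine CocycleExt.ext ?_ (inv_mul_cancel _)
      simp only [mul_def, one_def, inv_def]
      abel)

/-- The projection onto `G`. -/
def proj (hf : IsTrivialCocycle f) : CocycleExt hf →* G where
  toFun := right
  map_one' := rfl
  map_mul' _ _ := rfl

theorem proj_surjective : Function.Surjective (proj hf) := fun g => ⟨⟨0, g⟩, rfl⟩

/-- The inclusion of `T`. -/
def incl (hf : IsTrivialCocycle f) : Multiplicative T →* CocycleExt hf :=
  MonoidHom.mk' (fun t => ⟨t.toAdd - f 1 1, 1⟩) fun a b => by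
    refine CocycleExt.ext ?_ (one_mul _).symm
    simp only [mul_def, toAdd_mul]
    abel

theorem incl_injective : Function.Injective (incl hf) := fun a b h => by
  have := congrArg left h
  exact Multiplicative.toAdd.injective (sub_left_injective this)

theorem mem_ker_proj_iff (x : CocycleExt hf) :
    x ∈ (proj hf).ker ↔ x ∈ (incl hf).range := by
  constructor
  · intro h
    have h1 : x.right = 1 := h
    refine ⟨Multiplicative.ofAdd (x.left + f 1 1), CocycleExt.ext ?_ h1.symm⟩
    exact add_sub_cancel_right _ _
  · rintro ⟨t, rfl⟩
    rfl

theorem ker_proj_le_center : (proj hf).ker ≤ Subgroup.center (CocycleExt hf) := by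
  intro x hx
  have h1 : x.right = 1 := hx
  rw [Subgroup.mem_center_iff]
  intro y
  refine CocycleExt.ext ?_ ?_
  · simp only [mul_def, h1, hf.one_left, hf.one_right]
    abel
  · simp [mul_def, h1]

theorem incl_factor (g h : G) :
    incl hf (Multiplicative.ofAdd (f g h)) = (⟨0, g⟩ * ⟨0, h⟩ * (⟨0, g * h⟩)⁻¹ : CocycleExt hf) := by
  rw [eq_mul_inv_iff_mul_eq]
  refine CocycleExt.ext ?_ (one_mul _)
  change (f g h - f 1 1) + 0 + f 1 (g * h) = 0 + 0 + f g h
  rw [hf.one_left (g * h)]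
  abel

end CocycleExt

theorem isMulCommutative_ker {E : Type v} [Group E] {q : E →* G}
    (hc : q.ker ≤ Subgroup.center E) : IsMulCommutative q.ker :=
  ⟨⟨fun _ b => Subtype.ext (Subgroup.mem_center_iff.1 (hc b.2) _)⟩⟩

variable {E : Type v} [Group E] {q : E →* G}

/-- The factor set of a set-theoretic section of a central extension. -/
def sectionCocycle (s : G → E) (hs : ∀ g, q (s g) = g)
    (g h : G) : Additive q.ker :=
  Additive.ofMul ⟨s g * s h * (s (g * h))⁻¹, by simp [MonoidHom.mem_ker, hs]⟩

theorem sectionCocycle_spec (s : G → E) (hs : ∀ g, q (s g) = g) (g h : G) :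
    ((sectionCocycle s hs g h).toMul : E) * s (g * h) = s g * s h := by
  simp [sectionCocycle]

theorem isTrivialCocycle_sectionCocycle [IsMulCommutative q.ker]
    (hc : q.ker ≤ Subgroup.center E) (s : G → E)
    (hs : ∀ g, q (s g) = g) : IsTrivialCocycle (sectionCocycle s hs) := by
  intro g h j
  apply Additive.toMul.injective
  apply Subtype.ext
  change ((sectionCocycle s hs g h).toMul : E) * ((sectionCocycle s hs (g * h) j).toMul : E) =
    ((sectionCocycle s hs h j).toMul : E) * ((sectionCocycle s hs g (h * j)).toMul : E)
  refine mul_right_cancel (b := s (g * h * j)) ?_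
  rw [mul_assoc, sectionCocycle_spec, ← mul_assoc, sectionCocycle_spec, mul_assoc g h j, mul_assoc,
    mul_assoc, sectionCocycle_spec, ← sectionCocycle_spec s hs h j, ← mul_assoc, ← mul_assoc,
    Subgroup.mem_center_iff.1 (hc (sectionCocycle s hs h j).toMul.2)]

/-- A homomorphism of kernels compatible with the factor sets induces a map of extensions. -/
def CocycleExt.toExtension [IsMulCommutative q.ker] (hf : IsTrivialCocycle f) (hc : q.ker ≤ Subgroup.center E) (s : G → E)
    (hs : ∀ g, q (s g) = g) (c : T →+ Additive q.ker)
    (hcf : ∀ g h, c (f g h) = sectionCocycle s hs g h) : CocycleExt hf →* E :=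
  MonoidHom.mk' (fun x => ((c x.left).toMul : E) * s x.right) fun x y => by
    have h1 := Subgroup.mem_center_iff.1 (hc (c y.left).toMul.2) (s x.right)
    simp only [mul_def, map_add, hcf, toMul_add, Subgroup.coe_mul]
    rw [mul_assoc _ _ (s (x.right * y.right)), sectionCocycle_spec]
    simp only [mul_assoc]
    rw [← mul_assoc (s x.right) _ (s y.right), h1, mul_assoc]

theorem CocycleExt.comp_toExtension [IsMulCommutative q.ker] (hf : IsTrivialCocycle f)
    (hc : q.ker ≤ Subgroup.center E) (s : G → E) (hs : ∀ g, q (s g) = g) (c : T →+ Additive q.ker)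
    (hcf : ∀ g h, c (f g h) = sectionCocycle s hs g h) :
    q.comp (toExtension hf hc s hs c hcf) = proj hf := by
  ext x
  change q (((c x.left).toMul : E) * s x.right) = x.right
  rw [map_mul, hs, MonoidHom.mem_ker.1 (c x.left).toMul.2, one_mul]

end CocycleExtension

/-! ### Comparison of kernels inside commutator subgroups -/

section Transfer

variable {E : Type v} {E' : Type w} {G : Type u} [Group E] [Group E'] [Group G]
  {q : E →* G} {q' : E' →* G}

theorem map_mem_commutator (φ : E →* E') {x : E} (hx : x ∈ commutator E) :
    φ x ∈ commutator E' := by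
  have h : (commutator E).map φ ≤ commutator E' := by
    rw [commutator_def, Subgroup.map_commutator]
    exact Subgroup.commutator_mono le_top le_top
  exact h (Subgroup.mem_map_of_mem _ hx)

/-- The part of the kernel inside the commutator subgroup is the same for central extensions of `G`
which map to each other over `G`. -/
def kerInfCommutatorEquiv (hc : q.ker ≤ Subgroup.center E) (hc' : q'.ker ≤ Subgroup.center E')
    (φ : E →* E') (hφ : q'.comp φ = q) (ψ : E' →* E) (hψ : q.comp ψ = q') :
    (q.ker ⊓ commutator E : Subgroup E) ≃* (q'.ker ⊓ commutator E' : Subgroup E') where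
  toFun x := ⟨φ x, by
    refine ⟨?_, map_mem_commutator φ x.2.2⟩
    exact (DFunLike.congr_fun hφ x.1).trans x.2.1⟩
  invFun x := ⟨ψ x, by
    refine ⟨?_, map_mem_commutator ψ x.2.2⟩
    exact (DFunLike.congr_fun hψ x.1).trans x.2.1⟩
  left_inv x := Subtype.ext (apply_eq_self_of_mem_commutator hc (ψ.comp φ)
    (by rw [← MonoidHom.comp_assoc, hψ, hφ]) x.2.2)
  right_inv x := Subtype.ext (apply_eq_self_of_mem_commutator hc' (φ.comp ψ)
    (by rw [← MonoidHom.comp_assoc, hφ, hψ]) x.2.2)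
  map_mul' x y := Subtype.ext (map_mul φ _ _)

end Transfer

/-! ### Hopf's formula via two-chains modulo boundaries -/

section Hopf

open scoped IsMulCommutative

open groupHomology Finsupp

variable (G : Type u) [Group G]

/-- The trivial `G`-module `ℤ`. -/
abbrev trivialInt : Rep (ULift.{u} ℤ) G := Rep.trivial (ULift.{u} ℤ) G (ULift.{u} ℤ)

/-- Two-chains of `G` modulo boundaries. -/
abbrev ChainsModBoundaries : Type u := (G × G →₀ ULift.{u} ℤ) ⧸ boundaries₂ (trivialInt G)

variable {G}

/-- The tautological factor set with values in the two-chains modulo boundaries. -/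
noncomputable def universalFactor (g h : G) : ChainsModBoundaries G :=
  Submodule.Quotient.mk (single (g, h) 1)

theorem isTrivialCocycle_universalFactor : IsTrivialCocycle (universalFactor (G := G)) := by
  intro g h j
  unfold universalFactor
  rw [← Submodule.Quotient.mk_add, ← Submodule.Quotient.mk_add, eq_comm, Submodule.Quotient.eq]
  refine ⟨single (g, h, j) 1, ?_⟩
  have h1 : (d₃₂ (trivialInt G)).hom (single (g, h, j) 1) =
    single (h, j) 1 - single (g * h, j) 1 + single (g, h * j) 1 - single (g, h) 1 :=
      d₃₂_single (A := trivialInt G) (g, h, j) 1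
  rw [h1]
  abel

theorem addHom_ext_of_single_one {α : Type*} {B : Type*} [AddCommGroup B]
    {φ ψ : (α →₀ ULift.{u} ℤ) →+ B} (h : ∀ a, φ (single a 1) = ψ (single a 1)) : φ = ψ := by
  refine Finsupp.addHom_ext fun a n => ?_
  have : single a n = n.down • single a (1 : ULift.{u} ℤ) := by
    rw [smul_single]
    congr 1
    apply ULift.ext
    simp
  rw [this, map_zsmul, map_zsmul, h]

/-- The additive map on finitely supported functions with prescribed values on generators. -/
noncomputable def liftSingle {α : Type*} {B : Type*} [AddCommGroup B] (b : α → B) :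
    (α →₀ ULift.{u} ℤ) →+ B :=
  Finsupp.liftAddHom fun a => ((zmultiplesHom B) (b a)).comp AddEquiv.ulift.toAddMonoidHom

theorem liftSingle_single {α : Type*} {B : Type*} [AddCommGroup B] (b : α → B) (a : α) :
    liftSingle.{u} b (single a 1) = b a := by
  have h : (AddEquiv.ulift (1 : ULift.{u} ℤ)) = 1 := rfl
  simp [liftSingle, h]

/-- A cocycle defines a homomorphism on two-chains modulo boundaries. -/
noncomputable def liftChains {B : Type*} [AddCommGroup B] {f : G → G → B} (hf : IsTrivialCocycle f) :
    ChainsModBoundaries G →+ B :=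
  QuotientAddGroup.lift (boundaries₂ (trivialInt G)).toAddSubgroup
    (liftSingle fun p : G × G => f p.1 p.2) (by
      rintro _ ⟨x, rfl⟩
      have h : (liftSingle.{u} fun p : G × G => f p.1 p.2).comp
          (d₃₂ (trivialInt G)).hom.toAddMonoidHom = 0 := by
        refine addHom_ext_of_single_one fun a => ?_
        obtain ⟨g, h, j⟩ := a
        have h1 : (d₃₂ (trivialInt G)).hom.toAddMonoidHom (single (g, h, j) 1) =
            single (h, j) 1 - single (g * h, j) 1 + single (g, h * j) 1 - single (g, h) 1 :=
          d₃₂_single (A := trivialInt G) (g, h, j) 1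
        rw [AddMonoidHom.comp_apply, h1, map_sub, map_add, map_sub]
        simp only [liftSingle_single, AddMonoidHom.zero_apply]
        rw [sub_add_eq_add_sub, ← hf g h j]
        abel
      exact DFunLike.congr_fun h x)

theorem liftChains_universalFactor {B : Type*} [AddCommGroup B] {f : G → G → B}
    (hf : IsTrivialCocycle f) (g h : G) : liftChains hf (universalFactor g h) = f g h :=
  liftSingle_single _ _

variable (G)

/-- The central extension of `G` with the tautological factor set. -/
abbrev UniversalExt : Type u := CocycleExt (isTrivialCocycle_universalFactor (G := G))

/-- The differential on two-chains modulo boundaries. -/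
noncomputable def diffChains : ChainsModBoundaries G →+ (G →₀ ULift.{u} ℤ) :=
  (Submodule.liftQ (boundaries₂ (trivialInt G)) (d₂₁ (trivialInt G)).hom fun _ hx =>
    boundaries₂_le_cycles₂ _ hx).toAddMonoidHom

variable {G}

theorem diffChains_universalFactor (g h : G) :
    diffChains G (universalFactor g h) = single h 1 - single (g * h) 1 + single g 1 :=
  d₂₁_single (A := trivialInt G) (g, h) 1

theorem diffChains_eq_zero_of_incl_mem {t : ChainsModBoundaries G}
    (ht : CocycleExt.incl isTrivialCocycle_universalFactor (Multiplicative.ofAdd t) ∈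
      commutator (UniversalExt G)) : diffChains G t = 0 := by
  -- Since the differential of `(g, h)` is `h - gh + g`, the map `(t, g) ↦ dt + g` is a homomorphism
  -- to an abelian group, hence kills commutators.
  let χ : UniversalExt G →* Multiplicative (G →₀ ULift.{u} ℤ) :=
    MonoidHom.mk' (fun x => Multiplicative.ofAdd (diffChains G x.left + single x.right 1))
      fun x y => by
        rw [← ofAdd_add]
        congr 1
        simp only [CocycleExt.mul_def, map_add, diffChains_universalFactor]
        abel
  have h1 : χ _ = 1 := Abelianization.commutator_subset_ker χ ht
  have h2 : diffChains G (t - universalFactor 1 1) + single 1 1 = 0 := h1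
  rw [map_sub, diffChains_universalFactor, mul_one] at h2
  rw [← h2]
  abel

/-- In the abelianization, the generator `(g, h)` becomes the class of `(0, g)(0, h)(0, gh)⁻¹`, so
the inclusion of chains factors through the differential. -/
theorem incl_mem_of_diffChains_eq_zero {t : ChainsModBoundaries G} (ht : diffChains G t = 0) :
    CocycleExt.incl isTrivialCocycle_universalFactor (Multiplicative.ofAdd t) ∈
      commutator (UniversalExt G) := by
  let ι : (G × G →₀ ULift.{u} ℤ) →+ Additive (Abelianization (UniversalExt G)) :=
    (MonoidHom.toAdditiveRight (Abelianization.of.comp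
      (CocycleExt.incl isTrivialCocycle_universalFactor))).comp
      (boundaries₂ (trivialInt G)).mkQ.toAddMonoidHom
  let L : (G →₀ ULift.{u} ℤ) →+ Additive (Abelianization (UniversalExt G)) :=
    liftSingle fun g => Additive.ofMul (Abelianization.of ⟨0, g⟩)
  have h : ι = L.comp (d₂₁ (trivialInt G)).hom.toAddMonoidHom := by
    refine addHom_ext_of_single_one fun ⟨g, h⟩ => ?_
    have h1 : (d₂₁ (trivialInt G)).hom.toAddMonoidHom (single (g, h) 1) =
      single h 1 - single (g * h) 1 + single g 1 := d₂₁_single (A := trivialInt G) (g, h) 1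
    rw [AddMonoidHom.comp_apply L, h1, map_add, map_sub]
    simp only [L, liftSingle_single]
    have h2 : ι (single (g, h) 1) = Additive.ofMul (Abelianization.of
      (CocycleExt.incl isTrivialCocycle_universalFactor
        (Multiplicative.ofAdd (universalFactor g h)))) := rfl
    rw [h2, CocycleExt.incl_factor]
    simp only [map_mul, map_inv, ofMul_mul, ofMul_inv]
    abel
  obtain ⟨c, rfl⟩ := Submodule.Quotient.mk_surjective _ t
  have h1 : ι c = L (diffChains G (Submodule.Quotient.mk c)) := DFunLike.congr_fun h c
  rw [ht, map_zero] at h1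
  rw [← Abelianization.ker_of]
  exact h1

/-- Hopf's formula for the extension with the tautological factor set. -/
theorem nonempty_integralH2_mulEquiv_universal :
    Nonempty (Multiplicative (IntegralH2 G) ≃*
      ((CocycleExt.proj (isTrivialCocycle_universalFactor (G := G))).ker ⊓
        commutator (UniversalExt G) : Subgroup (UniversalExt G))) := by
  let hU := isTrivialCocycle_universalFactor (G := G)
  let κ₀ : Multiplicative (cycles₂ (trivialInt G)) →* UniversalExt G :=
    (CocycleExt.incl hU).comp (AddMonoidHom.toMultiplicative
      ((boundaries₂ (trivialInt G)).mkQ.toAddMonoidHom.comp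
        (cycles₂ (trivialInt G)).subtype.toAddMonoidHom))
  let κ : Multiplicative (cycles₂ (trivialInt G)) →*
      ((CocycleExt.proj hU).ker ⊓ commutator (UniversalExt G) : Subgroup (UniversalExt G)) :=
    κ₀.codRestrict _ fun c => ⟨rfl, incl_mem_of_diffChains_eq_zero c.toAdd.2⟩
  have hκ : Function.Surjective κ := by
    rintro ⟨x, hx, hx'⟩
    obtain ⟨t, rfl⟩ := (CocycleExt.mem_ker_proj_iff x).1 hx
    obtain ⟨c, hc⟩ := Submodule.Quotient.mk_surjective _ t.toAdd
    obtain rfl : Multiplicative.ofAdd (Submodule.Quotient.mk c) = t := by rw [hc]; rfl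
    exact ⟨Multiplicative.ofAdd ⟨c, diffChains_eq_zero_of_incl_mem hx'⟩, rfl⟩
  let P : Multiplicative (cycles₂ (trivialInt G)) →* Multiplicative (IntegralH2 G) :=
    AddMonoidHom.toMultiplicative (H2π (trivialInt G)).hom.toAddMonoidHom
  have hP : Function.Surjective P := (ModuleCat.epi_iff_surjective (H2π (trivialInt G))).1
    inferInstance
  have hker : P.ker = κ.ker := by
    ext c
    have h1 : c ∈ P.ker ↔ c.toAdd.1 ∈ boundaries₂ (trivialInt G) :=
      H2π_eq_zero_iff (A := trivialInt G) c.toAdd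
    rw [h1, MonoidHom.mem_ker, Subtype.ext_iff]
    change _ ↔ CocycleExt.incl hU (Multiplicative.ofAdd (Submodule.Quotient.mk c.toAdd.1)) = 1
    rw [← map_one (CocycleExt.incl hU), CocycleExt.incl_injective.eq_iff,
      ← Submodule.Quotient.mk_eq_zero]
    rfl
  exact ⟨(QuotientGroup.quotientKerEquivOfSurjective P hP).symm.trans
    ((QuotientGroup.quotientMulEquivOfEq hker).trans
      (QuotientGroup.quotientKerEquivOfSurjective κ hκ))⟩

/-- **Hopf's formula**, for a central extension which maps to every central extension of `G`. -/
theorem nonempty_integralH2_mulEquiv {E : Type v} [Group E] {q : E →* G}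
    (hc : q.ker ≤ Subgroup.center E) (hq : Function.Surjective q)
    (Φ : E →* UniversalExt G) (hΦ : (CocycleExt.proj _).comp Φ = q) :
    Nonempty (Multiplicative (IntegralH2 G) ≃* (q.ker ⊓ commutator E : Subgroup E)) := by
  obtain ⟨e⟩ := nonempty_integralH2_mulEquiv_universal (G := G)
  have := isMulCommutative_ker hc
  choose s hs using hq
  -- The factor set of a section `s` of `q` gives a map back from the tautological extension, so the
  -- two extensions map to each other over `G`.
  exact ⟨e.trans (kerInfCommutatorEquiv CocycleExt.ker_proj_le_center hc
    (CocycleExt.toExtension isTrivialCocycle_universalFactor hc s hs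
      (liftChains (isTrivialCocycle_sectionCocycle hc s hs)) fun g h =>
        liftChains_universalFactor _ g h)
    (CocycleExt.comp_toExtension _ hc s hs _ _) Φ hΦ)⟩

end Hopf

/-! ### Characters of the kernel and the Schur multiplier -/

section Transgression

open scoped IsMulCommutative

open groupCohomology

/-- `ℂˣ` is divisible because `ℂ` is algebraically closed, hence injective by Baer's criterion. -/
theorem exists_extension_units_complex {A : Type v} [CommGroup A] (B : Subgroup A)
    (χ : B →* ℂˣ) : ∃ χ' : A →* ℂˣ, ∀ b : B, χ' b = χ b := by
  have hdiv : ∀ {n : ℤ}, n ≠ 0 → Function.Surjective fun a : Additive ℂˣ => n • a := by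
    have hnat : ∀ n : ℕ, n ≠ 0 → ∀ a : ℂˣ, ∃ b : ℂˣ, b ^ n = a := by
      intro n hn a
      obtain ⟨z, hz⟩ := IsAlgClosed.exists_pow_nat_eq (a : ℂ) (Nat.pos_of_ne_zero hn)
      have hz0 : z ≠ 0 := by
        rintro rfl
        rw [zero_pow hn] at hz
        exact a.ne_zero hz.symm
      exact ⟨Units.mk0 z hz0, Units.ext hz⟩
    intro n hn a
    obtain ⟨b, hb⟩ := hnat n.natAbs (Int.natAbs_ne_zero.2 hn) a.toMul
    rcases Int.natAbs_eq n with h | h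
    · refine ⟨Additive.ofMul b, ?_⟩
      change n • Additive.ofMul b = a
      rw [h, natCast_zsmul]
      exact hb
    · refine ⟨-Additive.ofMul b, ?_⟩
      change n • (-Additive.ofMul b) = a
      rw [h, neg_smul_neg, natCast_zsmul]
      exact hb
  let _ : DivisibleBy (Additive ℂˣ) ℤ := divisibleByOfSMulRightSurj _ _ hdiv
  obtain ⟨h, hh⟩ := (Module.Baer.of_divisible (Additive ℂˣ)).extension_property_addMonoidHom
    (MonoidHom.toAdditive B.subtype) (fun x y hxy => Subtype.ext hxy) (MonoidHom.toAdditive χ)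
  exact ⟨MonoidHom.toAdditive.symm h, fun b => DFunLike.congr_fun hh (Additive.ofMul b)⟩

variable {E : Type v} {G : Type u} [Group E] [Group G] {q : E →* G}

/-- The trivial `G`-module `ℂˣ`. -/
abbrev trivialUnits (G : Type u) [Group G] : Rep (ULift.{u} ℤ) G :=
  Rep.trivial (ULift.{u} ℤ) G (Additive (ULift.{u} ℂˣ))

/-- The two-cocycle obtained by applying a character of the kernel to a factor set. -/
noncomputable def transgressionCocycle [IsMulCommutative q.ker] (hc : q.ker ≤ Subgroup.center E)
    (s : G → E) (hs : ∀ g, q (s g) = g) (χ : q.ker →* ℂˣ) : cocycles₂ (trivialUnits G) :=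
  ⟨fun p => Additive.ofMul (ULift.up (χ (sectionCocycle s hs p.1 p.2).toMul)), by
    refine (mem_cocycles₂_iff (A := trivialUnits G) _).2 fun g h j => ?_
    have h1 := congrArg (fun a => Additive.ofMul (ULift.up.{u} (χ a.toMul)))
      (isTrivialCocycle_sectionCocycle hc s hs g h j)
    simp only [toMul_add, map_mul] at h1
    exact (add_comm _ _).trans h1⟩

/-- If `y` is a cochain whose coboundary is the difference of the two cocycles, then `a * s g ↦ (χ₁
/ χ₂) a * y g` is a homomorphism on `E` extending `χ₁ / χ₂`, and so is trivial on commutators. -/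
theorem eq_on_commutator_of_transgression_eq [IsMulCommutative q.ker]
    (hc : q.ker ≤ Subgroup.center E) (s : G → E) (hs : ∀ g, q (s g) = g) (χ₁ χ₂ : q.ker →* ℂˣ)
    (h : H2π (trivialUnits G) (transgressionCocycle hc s hs χ₁) =
      H2π (trivialUnits G) (transgressionCocycle hc s hs χ₂))
    (a : q.ker) (ha : (a : E) ∈ commutator E) : χ₁ a = χ₂ a := by
  rw [H2π_eq_iff] at h
  obtain ⟨x, hx⟩ := h
  let y : G → ℂˣ := fun g => (Additive.toMul (x g) : ULift.{u} ℂˣ).down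
  let ζ : q.ker →* ℂˣ := χ₁ / χ₂
  have hζ : ∀ g h, ζ (sectionCocycle s hs g h).toMul = y h / y (g * h) * y g := by
    intro g h
    have := congrFun hx (g, h)
    exact (congrArg (fun z : Additive (ULift.{u} ℂˣ) => z.toMul.down) this).symm
  have hmem : ∀ e : E, e * (s (q e))⁻¹ ∈ q.ker := fun e => by simp [MonoidHom.mem_ker, hs]
  let lam : E →* ℂˣ := MonoidHom.mk' (fun e => ζ ⟨_, hmem e⟩ * y (q e)) fun e e' => by
    have h1 : (⟨_, hmem (e * e')⟩ : q.ker) =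
        ⟨_, hmem e⟩ * ⟨_, hmem e'⟩ * (sectionCocycle s hs (q e) (q e')).toMul := by
      apply Subtype.ext
      change e * e' * (s (q (e * e')))⁻¹ = e * (s (q e))⁻¹ * (e' * (s (q e'))⁻¹) *
        (s (q e) * s (q e') * (s (q e * q e'))⁻¹)
      have h2 := Subgroup.mem_center_iff.1 (hc (hmem e')) (s (q e))⁻¹
      rw [mul_assoc e (s (q e))⁻¹, h2, map_mul]
      group
    rw [h1, map_mul, map_mul, hζ, map_mul, div_eq_mul_inv]
    have := mul_inv_cancel (y (q e * q e'))
    calc _ = ζ ⟨_, hmem e⟩ * ζ ⟨_, hmem e'⟩ * y (q e') * y (q e) *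
          (y (q e * q e') * (y (q e * q e'))⁻¹) := by ac_rfl
      _ = _ := by rw [this, mul_one]; ac_rfl
  have hs1 : s 1 ∈ q.ker := hs 1
  have h1 : ζ ⟨s 1, hs1⟩ = y 1 := by
    have h2 := hζ 1 1
    rw [mul_one, div_self', one_mul] at h2
    rw [← h2]
    congr 1
    apply Subtype.ext
    change s 1 = s 1 * s 1 * (s (1 * 1))⁻¹
    simp
  have h2 : lam a = 1 := Abelianization.commutator_subset_ker lam ha
  have h3 : lam a = ζ a := by
    have h4 : q a = 1 := a.2
    change ζ ⟨_, hmem a⟩ * y (q a) = ζ a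
    rw [congrArg y h4, ← h1, ← map_mul]
    congr 1
    apply Subtype.ext
    change (a : E) * (s (q a))⁻¹ * s 1 = a
    rw [h4, inv_mul_cancel_right]
  rw [h3] at h2
  exact div_eq_one.1 h2

end Transgression

/-! ### Comparison of a central extension with a cover -/

section Cover

open scoped IsMulCommutative

open groupCohomology

variable {E : Type v} {E' : Type w} {G : Type u} [Group E] [Group E'] [CommGroup G]
  {q : E →* G} {q' : E' →* G}

theorem commutatorElement_eq_of_apply_eq (hc : q.ker ≤ Subgroup.center E) {a a' b b' : E}
    (ha : q a = q a') (hb : q b = q b') : ⁅a, b⁆ = ⁅a', b'⁆ := by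
  have key : ∀ {c d d' : E}, q d = q d' → ⁅c, d⁆ = ⁅c, d'⁆ := by
    intro c d d' h
    have h1 : d⁻¹ * d' ∈ q.ker := by rw [MonoidHom.mem_ker, map_mul, map_inv, h, inv_mul_cancel]
    have h2 : commutatorHom hc c (d⁻¹ * d') = 1 := by
      rw [commutatorHom_apply, commutatorElement_eq_one_iff_mul_comm]
      exact Subgroup.mem_center_iff.1 (hc h1) _
    rw [map_mul, map_inv, inv_mul_eq_one] at h2
    exact h2
  rw [key hb, ← commutatorElement_inv, key ha, commutatorElement_inv]

/-- `E` may be infinite, but its commutators depend only on images in `G`, and a group with finitely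
many commutators has finite commutator subgroup. -/
theorem finite_commutator [Finite G] (hc : q.ker ≤ Subgroup.center E)
    (hq : Function.Surjective q) : Finite (commutator E) := by
  choose s hs using hq
  have h1 : commutatorSet E ⊆ Set.range fun p : G × G => ⁅s p.1, s p.2⁆ := by
    rintro _ ⟨a, b, rfl⟩
    exact ⟨(q a, q b), commutatorElement_eq_of_apply_eq hc (hs _) (hs _)⟩
  have : Finite (commutatorSet E) := (Set.finite_range _).subset h1
  infer_instance

/-- The finite abelian group `[E, E]` has as many characters as elements; extended to the kernel,
they have distinct transgressions. -/
theorem card_commutator_le [Finite G] (hc : q.ker ≤ Subgroup.center E)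
    (hq : Function.Surjective q) [Finite (SchurMultiplier G)] :
    Nat.card (commutator E) ≤ Nat.card (SchurMultiplier G) := by
  have := isMulCommutative_ker hc
  have := finite_commutator hc hq
  let B : Subgroup q.ker := (commutator E).subgroupOf q.ker
  let e : B ≃* commutator E := Subgroup.subgroupOfEquivOfLe (commutator_le_ker q)
  have : Finite B := Finite.of_equiv _ e.symm.toEquiv
  choose s hs using hq
  choose ext hext using exists_extension_units_complex B
  have hinj : Function.Injective fun χ : B →* ℂˣ =>
      H2π (trivialUnits G) (transgressionCocycle hc s hs (ext χ)) := by
    intro χ₁ χ₂ h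
    ext b
    rw [← hext, ← hext, eq_on_commutator_of_transgression_eq hc s hs _ _ h b.1 b.2]
  have : NeZero (Monoid.exponent B) := ⟨Monoid.exponent_ne_zero_of_finite⟩
  rw [← Nat.card_congr e.toEquiv, ← CommGroup.card_monoidHom_of_hasEnoughRootsOfUnity B ℂ]
  exact Nat.card_le_card_of_injective _ hinj

theorem commutator_le_map (hq : Function.Surjective q) (hc' : q'.ker ≤ Subgroup.center E')
    (φ : E →* E') (hφ : q'.comp φ = q) : commutator E' ≤ (commutator E).map φ := by
  rw [commutator_def E', Subgroup.commutator_le]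
  intro a _ b _
  obtain ⟨x, hx⟩ := hq (q' a)
  obtain ⟨y, hy⟩ := hq (q' b)
  have hφ' : ∀ x, q' (φ x) = q x := DFunLike.congr_fun hφ
  rw [commutatorElement_eq_of_apply_eq hc' (a' := φ x) (b' := φ y) (by rw [hφ', hx])
    (by rw [hφ', hy]), ← map_commutatorElement]
  exact Subgroup.mem_map_of_mem _ (Subgroup.commutator_mem_commutator trivial trivial)

/-- For abelian `G` the kernel of a cover equals its commutator subgroup, of the order of the Schur
multiplier. Thus `[E, E]` surjects onto a finite group at least as large as itself. -/
theorem IsGroupCover.eq_one_of_apply_eq_one [Finite G] (h : IsGroupCover q')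
    (hq : Function.Surjective q) (hc : q.ker ≤ Subgroup.center E)
    (φ : E →* E') (hφ : q'.comp φ = q) {x : E} (hx : x ∈ commutator E) (hx1 : φ x = 1) :
    x = 1 := by
  have := finite_commutator hc hq
  have := finite_commutator h.ker_le_center h.surjective
  have hker : q'.ker = commutator E' := le_antisymm h.ker_le_commutator (commutator_le_ker q')
  obtain ⟨e⟩ := h.ker_iso
  let e' := (MulEquiv.subgroupCongr hker).symm.trans e
  have hfin : Finite (SchurMultiplier G) :=
    Finite.of_equiv _ (e'.toEquiv.trans Multiplicative.toAdd)
  let r : commutator E → commutator E' := fun x => ⟨φ x, map_mem_commutator φ x.2⟩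
  have hr : Function.Surjective r := by
    rintro ⟨y, hy⟩
    obtain ⟨x, hx, rfl⟩ := commutator_le_map hq h.ker_le_center φ hφ hy
    exact ⟨⟨x, hx⟩, rfl⟩
  have hcard : Nat.card (commutator E) ≤ Nat.card (commutator E') := by
    rw [Nat.card_congr (e'.toEquiv.trans Multiplicative.toAdd)]
    exact card_commutator_le hc hq
  have hinj := (hr.bijective_of_nat_card_le hcard).1
  exact congrArg Subtype.val (@hinj ⟨x, hx⟩ 1 (Subtype.ext (hx1.trans (map_one φ).symm)))

/-- The image of the centre is the radical of the commutator pairing on `G`; `φ` carries one pairing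
to the other and is injective on commutators. -/
theorem IsGroupCover.map_center_eq [Finite G] (h : IsGroupCover q') (hq : Function.Surjective q)
    (hc : q.ker ≤ Subgroup.center E) (φ : E →* E') (hφ : q'.comp φ = q) :
    (Subgroup.center E).map q = (Subgroup.center E').map q' := by
  have hφ' : ∀ x, q' (φ x) = q x := DFunLike.congr_fun hφ
  ext g
  constructor
  · rintro ⟨x, hx, rfl⟩
    refine ⟨φ x, ?_, hφ' x⟩
    refine Subgroup.mem_center_iff.2 fun y => ?_
    obtain ⟨z, hz⟩ := hq (q' y)
    rw [← commutatorElement_eq_one_iff_mul_comm,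
      commutatorElement_eq_of_apply_eq h.ker_le_center (a' := φ z) (b' := φ x)
        (by rw [hφ', hz]) rfl, ← map_commutatorElement,
      commutatorElement_eq_one_iff_mul_comm.2 (Subgroup.mem_center_iff.1 hx z), map_one]
  · rintro ⟨y, hy, rfl⟩
    obtain ⟨x, hx⟩ := hq (q' y)
    refine ⟨x, ?_, hx⟩
    refine Subgroup.mem_center_iff.2 fun z => ?_
    rw [← commutatorElement_eq_one_iff_mul_comm]
    refine h.eq_one_of_apply_eq_one hq hc φ hφ
      (Subgroup.commutator_mem_commutator trivial trivial) ?_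
    rw [map_commutatorElement, commutatorElement_eq_of_apply_eq h.ker_le_center (a' := φ z)
      (b' := y) rfl (by rw [hφ', hx]), commutatorElement_eq_one_iff_mul_comm]
    exact Subgroup.mem_center_iff.1 hy _

end Cover

/-! ### The main theorem -/

theorem proposition4p7 {p : ℕ} [Fact p.Prime] {G : Type*} [CommGroup G] [Finite G]
    (hG : IsPGroup p G) (n : ℕ) (hn : 3 ≤ n)
    -- two presentations of `G` by free groups, one used for `n` and one for `n - 1`
    {F : Type*} [Group F] [IsFreeGroup F] (π : F →* G) (hπ : Function.Surjective π)
    {F' : Type*} [Group F'] [IsFreeGroup F'] (π' : F' →* G) (hπ' : Function.Surjective π') :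
    (Monoid.exponent G ∣ n → Nonempty (KTilde π n ≃* G × KTilde π' (n - 1))) ∧
    (¬ p ∣ n →
      -- for every cover `q : E → G`, with `Z` the image of the centre of `E`
      ∀ {E : Type*} [Group E] (q : E →* G), IsGroupCover q →
        Nonempty (Subgroup.center (KTilde π n) ≃*
          Multiplicative (IntegralH2 G) × KGroup ((Subgroup.center E).map q) n)) := by
  have hc := centralQuot_ker_le π
  have hs := centralQuot_surjective hπ
  refine ⟨fun hexp => ?_, fun hpn E _ q hq => ?_⟩
  · obtain ⟨m, rfl⟩ : ∃ m, n = m + 1 := ⟨n - 1, by omega⟩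
    rw [Nat.add_sub_cancel]
    have hm : 2 ≤ m := by omega
    have hc' := centralQuot_ker_le π'
    obtain ⟨φ, hφ⟩ := exists_lift_centralQuot π (centralQuot π') (centralQuot_surjective hπ') hc'
    obtain ⟨ψ, hψ⟩ := exists_lift_centralQuot π' (centralQuot π) hs hc
    obtain ⟨e⟩ := nonempty_mulEquiv_prod hc hs hm hexp
    exact ⟨(MulEquiv.ofBijective _ (KTilde.bijective_map_mk π (by omega))).trans
      (e.trans (MulEquiv.prodCongr (MulEquiv.refl G)
        ((KTilde.equiv hc hc' φ hφ ψ hψ hm).trans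
          (MulEquiv.ofBijective _ (KTilde.bijective_map_mk π' hm)).symm)))⟩
  · obtain ⟨φ, hφ⟩ := exists_lift_centralQuot π q hq.surjective hq.ker_le_center
    obtain ⟨Φ, hΦ⟩ := exists_lift_centralQuot π _ CocycleExt.proj_surjective
      (CocycleExt.ker_proj_le_center (hf := isTrivialCocycle_universalFactor (G := G)))
    obtain ⟨e₁⟩ := nonempty_integralH2_mulEquiv hc hs Φ hΦ
    obtain ⟨e₂⟩ := nonempty_center_mulEquiv (n := n) hc (by omega) fun g hg => by
      -- The order of `g` is a power of `p`, so `g` is itself a power of `g ^ n`.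
      have hco : n.Coprime (orderOf g) := by
        obtain ⟨k, hk⟩ := IsPGroup.iff_orderOf.1 hG g
        rw [hk]
        exact (((Fact.out : p.Prime).coprime_iff_not_dvd.2 hpn).symm).pow_right k
      obtain ⟨m, hm⟩ := exists_pow_eq_self_of_coprime hco
      rw [← hm]
      exact pow_mem hg m
    rw [← hq.map_center_eq hs hc φ hφ]
    have hinf : (centralQuot π).ker ⊓ commutator _ = commutator _ :=
      inf_eq_right.2 (commutator_le_ker _)
    exact ⟨(Subgroup.centerCongr
      (MulEquiv.ofBijective _ (KTilde.bijective_map_mk π (by omega)))).trans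
        (e₂.trans (MulEquiv.prodCongr
          ((MulEquiv.subgroupCongr hinf).symm.trans e₁.symm) (MulEquiv.refl _)))⟩
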